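/- Let $K$ be a field and let $H$ be a bialgebra over $K$. Sweedler notation $\Delta(c)=c_1\otimes c_2$ is used for coproducts, iterated in the usual way. Let $A$ and $B$ be $K$-vector spaces, each of which is both a (unital, associative) algebra and a coalgebra, with no compatibility assumed beyond $\varepsilon_A(1_A)=1$ and $\varepsilon_B(1_B)=1$. Assume the following. * $A$ is a left $H$-comodule coalgebra with coaction $a\mapsto a_{-1}\otimes a_0\in H\otimes A$, i.e. this is a left coaction such that $a_{-1}\otimes a_{01}\otimes a_{02}=a_{1-1}a_{2-1}\otimes a_{10}\otimes a_{20}$ and $\varepsilon_A(a_0)a_{-1}=\varepsilon_A(a)1_H$. * $\triangleright:H\otimes A\to A$ is a left weak action: $1_H\triangleright a=a$, $x\triangleright 1_A=\varepsilon_H(x)1_A$, $x\triangleright(aa')=(x_1\triangleright a)(x_2\triangleright a')$. * $\sigma:H\otimes H\to A$ is a linear map with $\varepsilon_A(\sigma(x,x'))=\varepsilon_H(x)\varepsilon_H(x')$ which together with $\triangleright$ defines a left crossed product $A\#^\sigma H$, i.e. $\sigma(x,1_H)=\sigma(1_H,x)=\varepsilon_H(x)1_A$, $(x_1\triangleright\sigma(x'_1,x''_1))\sigma(x_2,x'_2x''_2)=\sigma(x_1,x'_1)\sigma(x_2x'_2,x'')$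 and $(x_1\triangleright(x'_1\triangleright a))\sigma(x_2,x'_2)=\sigma(x_1,x'_1)(x_2x'_2\triangleright a)$. * $B$ is a right $H$-module algebra with action $\triangleleft:B\otimes H\to B$, and a right $H$-comodule coalgebra with coaction $b\mapsto b_{[0]}\otimes b_{[1]}\in B\otimes H$, i.e. this is a right coaction such that $b_{[0]1}\otimes b_{[0]2}\otimes b_{[1]}=b_{1[0]}\otimes b_{2[0]}\otimes b_{1[1]}b_{2[1]}$ and $\varepsilon_B(b_{[0]})b_{[1]}=\varepsilon_B(b)1_H$. Equip the vector space $A\otimes H\otimes B$ with the one-sided crossed product $A\#^\sigma H\#B$, that is, with the unit $1_A\otimes 1_H\otimes 1_B$ and the multiplication $$(a\otimes x\otimes b)(a'\otimes x'\otimes b')=a(x_1\triangleright a')\sigma(x_2,x'_1)\otimes x_3x'_2\otimes(b\triangleleft x'_3)b',$$ and with the two-sided smash coproduct $A\times H\times B$, that is, with the counit $\varepsilon_A\otimes\varepsilon_H\otimes\varepsilon_B$ and the comultiplication $$\Delta(a\otimes x\otimes b)=a_1\otimes a_{2-1}x_1\otimes b_{1[0]}\otimes a_{20}\otimes x_2b_{1[1]}\otimes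 b_2 .$$ With these structures $A\otimes H\otimes B$ is a bialgebra if and only if the following conditions hold for all $a,a'\in A$, $x,x'\in H$, $b,b'\in B$: * (C1) $\varepsilon_A$ and $\varepsilon_B$ are algebra maps; * (C2) $\Delta_A(1_A)=1_A\otimes 1_A$ and $\Delta_B(1_B)=1_B\otimes 1_B$; * (C3) $1_{A\,-1}\otimes 1_{A\,0}=1_H\otimes 1_A$ and $1_{B[0]}\otimes 1_{B[1]}=1_B\otimes 1_H$; * (C4) $\varepsilon_A(x\triangleright a)=\varepsilon_A(a)\varepsilon_H(x)$ and $\varepsilon_B(b\triangleleft x)=\varepsilon_B(b)\varepsilon_H(x)$; * (C5) $a_1\otimes a_{2-1}x\otimes a_{20}=a_1\sigma(a_{2-11},x_1)\otimes a_{2-12}x_2\otimes a_{20}$; * (D7) $(aa')_1\otimes(aa')_2=a_1(a_{2-11}\triangleright a'_1)\sigma(a_{2-12},a'_{2-1})\otimes a_{20}a'_{20}$; * (D8) $(aa')_{-1}\otimes(aa')_0=a_{-1}a'_{-1}\otimes a_0a'_0$; * (D10) $(bb')_{[0]}\otimes(bb')_{[1]}=b_{[0]}b'_{[0]}\otimes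 b_{[1]}b'_{[1]}$; * (D11) $\sigma(x_1,x'_1)_{-1}x_2x'_2\otimes\sigma(x_1,x'_1)_0=x_1x'_1\otimes\sigma(x_2,x'_2)$; * (D12) $\sigma(x,x')_1\otimes\sigma(x,x')_2=\sigma(x_1,x'_1)\otimes\sigma(x_2,x'_2)$; * (D15) $(x\triangleright a)_1\otimes(x\triangleright a)_2=(x_1\triangleright a_1)\sigma(x_2,a_{2-1})\otimes(x_3\triangleright a_{20})$; * (D16) $(x_1\triangleright a)_{-1}x_2\otimes(x_1\triangleright a)_0=x_1a_{-1}\otimes(x_2\triangleright a_0)$; * (D17) $(b\triangleleft x_2)_{[0]}\otimes x_1(b\triangleleft x_2)_{[1]}=(b_{[0]}\triangleleft x_1)\otimes b_{[1]}x_2$; * (D20) $b_{[0]}\otimes 1_A\otimes xb_{[1]}=b_{[0]}\otimes\sigma(x_1,b_{[1]1})\otimes x_2b_{[1]2}$; * (D21) $(b_{[1]}\triangleright a_0)\otimes(b_{[0]}\triangleleft a_{-1})=a\otimes b$; * (E1) $(bb')_1\otimes(bb')_2=b_1b'_{1[0]}\otimes(b_2\triangleleft b'_{1[1]})b'_2$;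 * (E2) $(b\triangleleft x)_1\otimes(b\triangleleft x)_2=(b_1\triangleleft x_1)\otimes(b_2\triangleleft x_2)$; * (E3) $(b\triangleleft x'_2)b'\otimes(x_1\triangleright a)\sigma(x_2,x'_1)=(b_{[0]}\triangleleft x'_1)b'_{[0]}\otimes(x_1\triangleright a)\sigma(x_2b_{[1]},x'_2b'_{[1]})$. -/

import Mathlib

open Coalgebra
open scoped TensorProduct

namespace CrossedBiproduct

universe u v w z

section Sweedler

variable (K : Type u) [Field K] {M N P : Type*} [AddCommGroup M] [Module K M]
  [AddCommGroup N] [Module K N] [AddCommGroup P] [Module K P]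

/-- Sweedler summation. Write `t = ∑ᵢ mᵢ ⊗ nᵢ` as a finite sum of pure tensors; then
`sweedler K t f = ∑ᵢ f mᵢ nᵢ`. In all uses below `f` is bilinear, so that the value does not
depend on the chosen presentation of `t` (see `sweedler_eq_lift`). For instance
`sweedler K (comul a) fun a₁ a₂ => f a₁ a₂` is what is written `f(a₁, a₂)` in Sweedler notation. -/
noncomputable def sweedler (t : M ⊗[K] N) (f : M → N → P) : P :=
  ∑ p ∈ (TensorProduct.exists_finset t).choose, f p.1 p.2

/-- For bilinear `f`, Sweedler summation is the linear map on `M ⊗ N` induced by `f`. -/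
theorem sweedler_eq_lift (t : M ⊗[K] N) (f : M → N → P) (F : M →ₗ[K] N →ₗ[K] P)
    (h : ∀ m n, F m n = f m n) : sweedler K t f = TensorProduct.lift F t := by
  have ht := (TensorProduct.exists_finset t).choose_spec
  conv_rhs => rw [ht]
  simp only [sweedler, map_sum, TensorProduct.lift.tmul, h]

end Sweedler

section Structures

variable {K : Type u} [Field K] {H : Type v} [Ring H] [Bialgebra K H]

/-- A left weak action `x ▷ a = lact x a` of the bialgebra `H` on the algebra `A`. -/
structure IsLeftWeakAction {A : Type w} [Ring A] [Algebra K A]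
    (lact : H →ₗ[K] A →ₗ[K] A) : Prop where
  one_act : ∀ a : A, lact 1 a = a
  act_one : ∀ x : H, lact x 1 = counit (R := K) x • (1 : A)
  act_mul : ∀ (x : H) (a a' : A),
    lact x (a * a') = sweedler K (comul x) fun x₁ x₂ => lact x₁ a * lact x₂ a'

/-- `σ : H ⊗ H → A` (written as a bilinear map) is a normalized cocycle for the weak action `▷`,
and `A` is a twisted `H`-module. These are the data of a left crossed product `A #^σ H`, i.e. they
say that `A ⊗ H` with `(a ⊗ x)(a' ⊗ x') = a (x₁ ▷ a') σ(x₂, x'₁) ⊗ x₃ x'₂` is an associative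
algebra with unit `1 ⊗ 1`. -/
structure IsCrossedCocycle {A : Type w} [Ring A] [Algebra K A]
    (lact : H →ₗ[K] A →ₗ[K] A) (σ : H →ₗ[K] H →ₗ[K] A) : Prop where
  right_one : ∀ x : H, σ x 1 = counit (R := K) x • (1 : A)
  left_one : ∀ x : H, σ 1 x = counit (R := K) x • (1 : A)
  /-- `(x₁ ▷ σ(x'₁, x''₁)) σ(x₂, x'₂ x''₂) = σ(x₁, x'₁) σ(x₂ x'₂, x'')` -/
  cocycle : ∀ x x' x'' : H,
    (sweedler K (comul x) fun x₁ x₂ => sweedler K (comul x') fun x'₁ x'₂ =>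
      sweedler K (comul x'') fun x''₁ x''₂ => lact x₁ (σ x'₁ x''₁) * σ x₂ (x'₂ * x''₂)) =
    sweedler K (comul x) fun x₁ x₂ => sweedler K (comul x') fun x'₁ x'₂ =>
      σ x₁ x'₁ * σ (x₂ * x'₂) x''
  /-- `(x₁ ▷ (x'₁ ▷ a)) σ(x₂, x'₂) = σ(x₁, x'₁) (x₂ x'₂ ▷ a)` -/
  twisted_module : ∀ (x x' : H) (a : A),
    (sweedler K (comul x) fun x₁ x₂ => sweedler K (comul x') fun x'₁ x'₂ =>
      lact x₁ (lact x'₁ a) * σ x₂ x'₂) =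
    sweedler K (comul x) fun x₁ x₂ => sweedler K (comul x') fun x'₁ x'₂ =>
      σ x₁ x'₁ * lact (x₂ * x'₂) a

/-- `ρ a = a₋₁ ⊗ a₀` makes the coalgebra `A` a left `H`-comodule coalgebra. -/
structure IsLeftComoduleCoalgebra {A : Type w} [AddCommGroup A] [Module K A] [Coalgebra K A]
    (ρ : A →ₗ[K] H ⊗[K] A) : Prop where
  coassoc : ∀ a : A, TensorProduct.assoc K H H A ((comul (R := K) (A := H)).rTensor A (ρ a)) =
    ρ.lTensor H (ρ a)
  counit_coact : ∀ a : A, (counit (R := K) (A := H)).rTensor A (ρ a) = (1 : K) ⊗ₜ[K] a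
  /-- `a₋₁ ⊗ a₀₁ ⊗ a₀₂ = a₁₋₁ a₂₋₁ ⊗ a₁₀ ⊗ a₂₀` -/
  comul_coact : ∀ a : A,
    (sweedler K (ρ a) fun h a₀ => sweedler K (comul a₀) fun a₀₁ a₀₂ =>
      h ⊗ₜ[K] a₀₁ ⊗ₜ[K] a₀₂) =
    sweedler K (comul a) fun a₁ a₂ => sweedler K (ρ a₁) fun h a₁₀ => sweedler K (ρ a₂) fun k a₂₀ =>
      (h * k) ⊗ₜ[K] a₁₀ ⊗ₜ[K] a₂₀
  /-- `ε(a₀) a₋₁ = ε(a) 1` -/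
  counit_coalg : ∀ a : A, (sweedler K (ρ a) fun h a₀ => counit (R := K) a₀ • h) =
    counit (R := K) a • (1 : H)

/-- `b ◁ x = ract b x` makes the algebra `B` a right `H`-module algebra. -/
structure IsRightModuleAlgebra {B : Type z} [Ring B] [Algebra K B]
    (ract : B →ₗ[K] H →ₗ[K] B) : Prop where
  act_one : ∀ b : B, ract b 1 = b
  act_mul : ∀ (b : B) (x x' : H), ract b (x * x') = ract (ract b x) x'
  one_act : ∀ x : H, ract 1 x = counit (R := K) x • (1 : B)
  mul_act : ∀ (b b' : B) (x : H),
    ract (b * b') x = sweedler K (comul x) fun x₁ x₂ => ract b x₁ * ract b' x₂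

/-- `ψ b = b₍₀₎ ⊗ b₍₁₎` makes the coalgebra `B` a right `H`-comodule coalgebra. -/
structure IsRightComoduleCoalgebra {B : Type z} [AddCommGroup B] [Module K B] [Coalgebra K B]
    (ψ : B →ₗ[K] B ⊗[K] H) : Prop where
  coassoc : ∀ b : B, TensorProduct.assoc K B H H (ψ.rTensor H (ψ b)) =
    (comul (R := K) (A := H)).lTensor B (ψ b)
  counit_coact : ∀ b : B, (counit (R := K) (A := H)).lTensor B (ψ b) = b ⊗ₜ[K] (1 : K)
  /-- `b₍₀₎₁ ⊗ b₍₀₎₂ ⊗ b₍₁₎ = b₁₍₀₎ ⊗ b₂₍₀₎ ⊗ b₁₍₁₎ b₂₍₁₎` -/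
  comul_coact : ∀ b : B,
    (sweedler K (ψ b) fun b₀ h => sweedler K (comul b₀) fun b₀₁ b₀₂ =>
      b₀₁ ⊗ₜ[K] b₀₂ ⊗ₜ[K] h) =
    sweedler K (comul b) fun b₁ b₂ => sweedler K (ψ b₁) fun b₁₀ h => sweedler K (ψ b₂) fun b₂₀ k =>
      b₁₀ ⊗ₜ[K] b₂₀ ⊗ₜ[K] (h * k)
  /-- `ε(b₍₀₎) b₍₁₎ = ε(b) 1` -/
  counit_coalg : ∀ b : B, (sweedler K (ψ b) fun b₀ h => counit (R := K) b₀ • h) =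
    counit (R := K) b • (1 : H)

end Structures

section Biproduct

variable {K : Type u} [Field K] {H : Type v} [Ring H] [Bialgebra K H]
  {A : Type w} [Ring A] [Algebra K A] [Coalgebra K A]
  {B : Type z} [Ring B] [Algebra K B] [Coalgebra K B]

/-- The product `(a ⊗ x ⊗ b)(a' ⊗ x' ⊗ b')` in the one-sided crossed product `A #^σ H # B`:
`a (x₁ ▷ a') σ(x₂, x'₁) ⊗ x₃ x'₂ ⊗ (b ◁ x'₃) b'`. -/
noncomputable def crossedMul (lact : H →ₗ[K] A →ₗ[K] A) (σ : H →ₗ[K] H →ₗ[K] A)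
    (ract : B →ₗ[K] H →ₗ[K] B) (a : A) (x : H) (b : B) (a' : A) (x' : H) (b' : B) :
    A ⊗[K] H ⊗[K] B :=
  sweedler K (comul x) fun x₁ y => sweedler K (comul y) fun x₂ x₃ =>
    sweedler K (comul x') fun x'₁ y' => sweedler K (comul y') fun x'₂ x'₃ =>
      (a * lact x₁ a' * σ x₂ x'₁) ⊗ₜ[K] (x₃ * x'₂) ⊗ₜ[K] (ract b x'₃ * b')

/-- The coproduct of `a ⊗ x ⊗ b` in the two-sided smash coproduct `A × H × B`:
`(a₁ ⊗ a₂₋₁ x₁ ⊗ b₁₍₀₎) ⊗ (a₂₀ ⊗ x₂ b₁₍₁₎ ⊗ b₂)`. -/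
noncomputable def smashComul (ρ : A →ₗ[K] H ⊗[K] A) (ψ : B →ₗ[K] B ⊗[K] H)
    (a : A) (x : H) (b : B) : (A ⊗[K] H ⊗[K] B) ⊗[K] (A ⊗[K] H ⊗[K] B) :=
  sweedler K (comul a) fun a₁ a₂ => sweedler K (ρ a₂) fun h a₂₀ =>
    sweedler K (comul x) fun x₁ x₂ =>
      sweedler K (comul b) fun b₁ b₂ => sweedler K (ψ b₁) fun b₁₀ k =>
        (a₁ ⊗ₜ[K] (h * x₁) ⊗ₜ[K] b₁₀) ⊗ₜ[K] (a₂₀ ⊗ₜ[K] (x₂ * k) ⊗ₜ[K] b₂)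

/-- The vector space `A ⊗ H ⊗ B`, with the unit `1 ⊗ 1 ⊗ 1` and the product of the one-sided crossed
product `A #^σ H # B` and with the coproduct and the counit `ε ⊗ ε ⊗ ε` of the two-sided smash
coproduct `A × H × B`, is a bialgebra.

As `A ⊗ H ⊗ B` already carries other algebra and coalgebra structures, this is expressed on a copy
`W` of that vector space: `e` identifies `A ⊗ H ⊗ B` with a bialgebra `W` whose structure maps are
the prescribed ones. These are determined by their values on pure tensors. -/
def IsBiproductBialgebra (lact : H →ₗ[K] A →ₗ[K] A) (σ : H →ₗ[K] H →ₗ[K] A)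
    (ρ : A →ₗ[K] H ⊗[K] A) (ract : B →ₗ[K] H →ₗ[K] B) (ψ : B →ₗ[K] B ⊗[K] H) : Prop :=
  ∃ (W : Type (max v w z)) (_ : Ring W) (_ : Bialgebra K W) (e : (A ⊗[K] H ⊗[K] B) ≃ₗ[K] W),
    e ((1 : A) ⊗ₜ[K] (1 : H) ⊗ₜ[K] (1 : B)) = 1 ∧
    (∀ (a a' : A) (x x' : H) (b b' : B),
      e (a ⊗ₜ[K] x ⊗ₜ[K] b) * e (a' ⊗ₜ[K] x' ⊗ₜ[K] b') =
        e (crossedMul lact σ ract a x b a' x' b')) ∧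
    (∀ (a : A) (x : H) (b : B),
      comul (R := K) (e (a ⊗ₜ[K] x ⊗ₜ[K] b)) =
        TensorProduct.map e.toLinearMap e.toLinearMap (smashComul ρ ψ a x b)) ∧
    (∀ (a : A) (x : H) (b : B),
      counit (R := K) (e (a ⊗ₜ[K] x ⊗ₜ[K] b)) =
        counit (R := K) a * counit (R := K) x * counit (R := K) b)

/-- The list of compatibility conditions between the structure maps. -/
structure BiproductConditions (lact : H →ₗ[K] A →ₗ[K] A) (σ : H →ₗ[K] H →ₗ[K] A)
    (ρ : A →ₗ[K] H ⊗[K] A) (ract : B →ₗ[K] H →ₗ[K] B) (ψ : B →ₗ[K] B ⊗[K] H) : Prop where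
  /-- `ε_A` is an algebra map -/
  counit_alg_left : counit (R := K) (1 : A) = 1 ∧
    ∀ a a' : A, counit (R := K) (a * a') = counit (R := K) a * counit (R := K) a'
  /-- `ε_B` is an algebra map -/
  counit_alg_right : counit (R := K) (1 : B) = 1 ∧
    ∀ b b' : B, counit (R := K) (b * b') = counit (R := K) b * counit (R := K) b'
  comul_one_left : comul (R := K) (1 : A) = (1 : A) ⊗ₜ[K] (1 : A)
  comul_one_right : comul (R := K) (1 : B) = (1 : B) ⊗ₜ[K] (1 : B)
  coact_one_left : ρ 1 = (1 : H) ⊗ₜ[K] (1 : A)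
  coact_one_right : ψ 1 = (1 : B) ⊗ₜ[K] (1 : H)
  counit_act_left : ∀ (x : H) (a : A),
    counit (R := K) (lact x a) = counit (R := K) a * counit (R := K) x
  counit_act_right : ∀ (b : B) (x : H),
    counit (R := K) (ract b x) = counit (R := K) b * counit (R := K) x
  /-- `a₁ ⊗ a₂₋₁ x ⊗ a₂₀ = a₁ σ(a₂₋₁₁, x₁) ⊗ a₂₋₁₂ x₂ ⊗ a₂₀` -/
  twisted_comodule_cocycle : ∀ (a : A) (x : H),
    (sweedler K (comul a) fun a₁ a₂ => sweedler K (ρ a₂) fun h a₂₀ =>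
      a₁ ⊗ₜ[K] (h * x) ⊗ₜ[K] a₂₀) =
    sweedler K (comul a) fun a₁ a₂ => sweedler K (ρ a₂) fun h a₂₀ =>
      sweedler K (comul h) fun h₁ h₂ => sweedler K (comul x) fun x₁ x₂ =>
        (a₁ * σ h₁ x₁) ⊗ₜ[K] (h₂ * x₂) ⊗ₜ[K] a₂₀
  /-- `(aa')₁ ⊗ (aa')₂ = a₁ (a₂₋₁₁ ▷ a'₁) σ(a₂₋₁₂, a'₂₋₁) ⊗ a₂₀ a'₂₀` -/
  comul_mul_left : ∀ a a' : A,
    comul (R := K) (a * a') =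
    sweedler K (comul a) fun a₁ a₂ => sweedler K (ρ a₂) fun h a₂₀ =>
      sweedler K (comul h) fun h₁ h₂ =>
        sweedler K (comul a') fun a'₁ a'₂ => sweedler K (ρ a'₂) fun h' a'₂₀ =>
          (a₁ * lact h₁ a'₁ * σ h₂ h') ⊗ₜ[K] (a₂₀ * a'₂₀)
  /-- `(aa')₋₁ ⊗ (aa')₀ = a₋₁ a'₋₁ ⊗ a₀ a'₀` -/
  coact_mul_left : ∀ a a' : A,
    ρ (a * a') = sweedler K (ρ a) fun h a₀ => sweedler K (ρ a') fun h' a'₀ =>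
      (h * h') ⊗ₜ[K] (a₀ * a'₀)
  /-- `(bb')₍₀₎ ⊗ (bb')₍₁₎ = b₍₀₎ b'₍₀₎ ⊗ b₍₁₎ b'₍₁₎` -/
  coact_mul_right : ∀ b b' : B,
    ψ (b * b') = sweedler K (ψ b) fun b₀ k => sweedler K (ψ b') fun b'₀ k' =>
      (b₀ * b'₀) ⊗ₜ[K] (k * k')
  /-- `σ(x₁, x'₁)₋₁ x₂ x'₂ ⊗ σ(x₁, x'₁)₀ = x₁ x'₁ ⊗ σ(x₂, x'₂)` -/
  coact_cocycle : ∀ x x' : H,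
    (sweedler K (comul x) fun x₁ x₂ => sweedler K (comul x') fun x'₁ x'₂ =>
      sweedler K (ρ (σ x₁ x'₁)) fun h s₀ => (h * x₂ * x'₂) ⊗ₜ[K] s₀) =
    sweedler K (comul x) fun x₁ x₂ => sweedler K (comul x') fun x'₁ x'₂ =>
      (x₁ * x'₁) ⊗ₜ[K] σ x₂ x'₂
  /-- `σ(x, x')₁ ⊗ σ(x, x')₂ = σ(x₁, x'₁) ⊗ σ(x₂, x'₂)` -/
  comul_cocycle : ∀ x x' : H,
    comul (R := K) (σ x x') =
    sweedler K (comul x) fun x₁ x₂ => sweedler K (comul x') fun x'₁ x'₂ =>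
      σ x₁ x'₁ ⊗ₜ[K] σ x₂ x'₂
  /-- `(x ▷ a)₁ ⊗ (x ▷ a)₂ = (x₁ ▷ a₁) σ(x₂, a₂₋₁) ⊗ (x₃ ▷ a₂₀)` -/
  comul_act_left : ∀ (x : H) (a : A),
    comul (R := K) (lact x a) =
    sweedler K (comul x) fun x₁ y => sweedler K (comul y) fun x₂ x₃ =>
      sweedler K (comul a) fun a₁ a₂ => sweedler K (ρ a₂) fun h a₂₀ =>
        (lact x₁ a₁ * σ x₂ h) ⊗ₜ[K] lact x₃ a₂₀
  /-- `(x₁ ▷ a)₋₁ x₂ ⊗ (x₁ ▷ a)₀ = x₁ a₋₁ ⊗ (x₂ ▷ a₀)` -/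
  yetterDrinfeld_left : ∀ (x : H) (a : A),
    (sweedler K (comul x) fun x₁ x₂ => sweedler K (ρ (lact x₁ a)) fun h c₀ =>
      (h * x₂) ⊗ₜ[K] c₀) =
    sweedler K (comul x) fun x₁ x₂ => sweedler K (ρ a) fun h a₀ =>
      (x₁ * h) ⊗ₜ[K] lact x₂ a₀
  /-- `(b ◁ x₂)₍₀₎ ⊗ x₁ (b ◁ x₂)₍₁₎ = (b₍₀₎ ◁ x₁) ⊗ b₍₁₎ x₂` -/
  yetterDrinfeld_right : ∀ (b : B) (x : H),
    (sweedler K (comul x) fun x₁ x₂ => sweedler K (ψ (ract b x₂)) fun c₀ k =>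
      c₀ ⊗ₜ[K] (x₁ * k)) =
    sweedler K (comul x) fun x₁ x₂ => sweedler K (ψ b) fun b₀ k =>
      ract b₀ x₁ ⊗ₜ[K] (k * x₂)
  /-- `b₍₀₎ ⊗ 1 ⊗ x b₍₁₎ = b₍₀₎ ⊗ σ(x₁, b₍₁₎₁) ⊗ x₂ b₍₁₎₂` -/
  cocycle_coact_right : ∀ (b : B) (x : H),
    (sweedler K (ψ b) fun b₀ k => b₀ ⊗ₜ[K] (1 : A) ⊗ₜ[K] (x * k)) =
    sweedler K (ψ b) fun b₀ k => sweedler K (comul k) fun k₁ k₂ =>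
      sweedler K (comul x) fun x₁ x₂ => b₀ ⊗ₜ[K] σ x₁ k₁ ⊗ₜ[K] (x₂ * k₂)
  /-- `(b₍₁₎ ▷ a₀) ⊗ (b₍₀₎ ◁ a₋₁) = a ⊗ b` -/
  double_biproduct : ∀ (a : A) (b : B),
    (sweedler K (ρ a) fun h a₀ => sweedler K (ψ b) fun b₀ k =>
      lact k a₀ ⊗ₜ[K] ract b₀ h) = a ⊗ₜ[K] b
  /-- `(bb')₁ ⊗ (bb')₂ = b₁ b'₁₍₀₎ ⊗ (b₂ ◁ b'₁₍₁₎) b'₂` -/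
  comul_mul_right : ∀ b b' : B,
    comul (R := K) (b * b') =
    sweedler K (comul b) fun b₁ b₂ => sweedler K (comul b') fun b'₁ b'₂ =>
      sweedler K (ψ b'₁) fun b'₁₀ k => (b₁ * b'₁₀) ⊗ₜ[K] (ract b₂ k * b'₂)
  /-- `(b ◁ x)₁ ⊗ (b ◁ x)₂ = (b₁ ◁ x₁) ⊗ (b₂ ◁ x₂)` -/
  comul_act_right : ∀ (b : B) (x : H),
    comul (R := K) (ract b x) =
    sweedler K (comul b) fun b₁ b₂ => sweedler K (comul x) fun x₁ x₂ =>
      ract b₁ x₁ ⊗ₜ[K] ract b₂ x₂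
  /-- `(b ◁ x'₂) b' ⊗ (x₁ ▷ a) σ(x₂, x'₁)
    = (b₍₀₎ ◁ x'₁) b'₍₀₎ ⊗ (x₁ ▷ a) σ(x₂ b₍₁₎, x'₂ b'₍₁₎)` -/
  cocycle_act_coact : ∀ (a : A) (x x' : H) (b b' : B),
    (sweedler K (comul x) fun x₁ x₂ => sweedler K (comul x') fun x'₁ x'₂ =>
      (ract b x'₂ * b') ⊗ₜ[K] (lact x₁ a * σ x₂ x'₁)) =
    sweedler K (comul x) fun x₁ x₂ => sweedler K (comul x') fun x'₁ x'₂ =>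
      sweedler K (ψ b) fun b₀ k => sweedler K (ψ b') fun b'₀ k' =>
        (ract b₀ x'₁ * b'₀) ⊗ₜ[K] (lact x₁ a * σ (x₂ * k) (x'₂ * k'))

end Biproduct

end CrossedBiproduct

/-! The standing hypotheses alone make `A ⊗ H ⊗ B` an algebra and a coalgebra (`crossed_mul_assoc`,
`smash_comul_coassoc` and the unit and counit laws). So the theorem only asks when `Δ` and `ε`
respect products and units.

Sufficiency. Every element is a sum of products `a · x · b` of elements of the three factors. Call a
pair `(u, v)` good (`ComulMul`) if `Δ(uv) = Δ(u)Δ(v)`. Associativity in `W` and in `W ⊗ W` shows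
that goodness of `(u, v)` and `(v, w)` makes goodness of `(uv, w)` and of `(u, vw)` equivalent. It
therefore suffices to treat eight kinds of pairs of generators, and each is settled by a few of the
conditions: A·(HB) by (C5), H·B by (D20), A·A by (D7), (D8), B·B by (E1), (D10), (E3), H·H by (D11),
(D12), H·A by (D15), (D16), B·H by (E2), (D17), (E3), and B·A by (D21). `IsRealization.comul_mul`
assembles them. The counit is checked directly.

Necessity. Applying counits to unwanted tensor legs of `Δ(uv) = Δ(u)Δ(v)`, for `u` and `v`
generators, yields the conditions one by one; those on units and counits come from `Δ(1) = 1 ⊗ 1`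
and multiplicativity of `ε`. The exception is (E3): for `(1 ⊗ x ⊗ b)(a ⊗ x' ⊗ b')` the projected
identity still contains the coaction on `a`, and `IsSetting.sweedler_act_coact` removes it using
(D20), (D21) and the twisted module law.

All computations are done with `sweedler` sums. Multilinearity side goals go to `fun_prop`, and
tensor identities are used in the form "evaluated under an arbitrary multilinear `f`". -/

set_option linter.unusedSectionVars false

namespace CrossedBiproduct

universe u v w z

attribute [fun_prop] IsLinearMap

/-! ### Automation for linearity in each variable. -/

section Linearity

variable {K : Type*} [Field K] {M N P Q : Type*} [AddCommMonoid M] [Module K M]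
  [AddCommMonoid N] [Module K N] [AddCommMonoid P] [Module K P] [AddCommMonoid Q] [Module K Q]

@[fun_prop]
theorem isLinearMap_id : IsLinearMap K fun x : M => x := ⟨fun _ _ => rfl, fun _ _ => rfl⟩

@[fun_prop]
theorem isLinearMap_comp {f : N → P} {g : M → N} (hf : IsLinearMap K f) (hg : IsLinearMap K g) :
    IsLinearMap K fun x => f (g x) :=
  ⟨fun x y => by rw [hg.map_add, hf.map_add], fun c x => by rw [hg.map_smul, hf.map_smul]⟩

@[fun_prop]
theorem isLinearMap_apply_of (F : N →ₗ[K] P) {g : M → N} (hg : IsLinearMap K g) :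
    IsLinearMap K fun x => F (g x) :=
  isLinearMap_comp F.isLinear hg

@[fun_prop]
theorem isLinearMap_of_apply {F : M → N →ₗ[K] P} (hF : IsLinearMap K F) (n : N) :
    IsLinearMap K fun x => F x n :=
  ⟨fun x y => by rw [hF.map_add, LinearMap.add_apply], fun c x => by
    rw [hF.map_smul, LinearMap.smul_apply]⟩

@[fun_prop]
theorem isLinearMap_tmul_left {f : M → N} (hf : IsLinearMap K f) (p : P) :
    IsLinearMap K fun x => f x ⊗ₜ[K] p :=
  ⟨fun x y => by rw [hf.map_add, TensorProduct.add_tmul], fun c x => by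
    rw [hf.map_smul, TensorProduct.smul_tmul']⟩

@[fun_prop]
theorem isLinearMap_tmul_right {f : M → N} (hf : IsLinearMap K f) (p : P) :
    IsLinearMap K fun x => p ⊗ₜ[K] f x :=
  ⟨fun x y => by rw [hf.map_add, TensorProduct.tmul_add], fun c x => by
    rw [hf.map_smul, TensorProduct.tmul_smul]⟩

@[fun_prop]
theorem isLinearMap_mul_left {R : Type*} [Ring R] [Algebra K R] {f : M → R}
    (hf : IsLinearMap K f) (r : R) : IsLinearMap K fun x => f x * r :=
  ⟨fun x y => by rw [hf.map_add, add_mul], fun c x => by rw [hf.map_smul, smul_mul_assoc]⟩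

@[fun_prop]
theorem isLinearMap_mul_right {R : Type*} [Ring R] [Algebra K R] {f : M → R}
    (hf : IsLinearMap K f) (r : R) : IsLinearMap K fun x => r * f x :=
  ⟨fun x y => by rw [hf.map_add, mul_add], fun c x => by rw [hf.map_smul, mul_smul_comm]⟩

@[fun_prop]
theorem isLinearMap_smul_left {f : M → K} (hf : IsLinearMap K f) (n : N) :
    IsLinearMap K fun x => f x • n :=
  ⟨fun x y => by rw [hf.map_add, add_smul], fun c x => by rw [hf.map_smul, smul_assoc]⟩

@[fun_prop]
theorem isLinearMap_smul_right {f : M → N} (hf : IsLinearMap K f) (c : K) :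
    IsLinearMap K fun x => c • f x :=
  ⟨fun x y => by rw [hf.map_add, smul_add], fun c x => by rw [hf.map_smul, smul_comm]⟩

end Linearity

section Linearity

variable {K : Type*} [Field K] {M N P Q : Type*} [AddCommGroup M] [Module K M]
  [AddCommGroup N] [Module K N] [AddCommGroup P] [Module K P] [AddCommMonoid Q] [Module K Q]

theorem sweedler_eq_lift_mk (t : M ⊗[K] N) (f : M → N → P)
    (hl : ∀ n, IsLinearMap K fun m => f m n) (hr : ∀ m, IsLinearMap K fun n => f m n) :
    sweedler K t f = TensorProduct.lift (LinearMap.mk₂ K f (fun m m' n => (hl n).map_add m m')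
      (fun c m n => (hl n).map_smul c m) (fun m n n' => (hr m).map_add n n')
      (fun c m n => (hr m).map_smul c n)) t :=
  sweedler_eq_lift K t f _ fun _ _ => rfl

@[fun_prop]
theorem isLinearMap_sweedler_left {t : Q → M ⊗[K] N} {f : M → N → P} (ht : IsLinearMap K t)
    (hl : ∀ n, IsLinearMap K fun m => f m n) (hr : ∀ m, IsLinearMap K fun n => f m n) :
    IsLinearMap K fun q => sweedler K (t q) f := by
  simp only [sweedler_eq_lift_mk _ f hl hr]
  fun_prop

-- The chosen presentation of `t` is fixed, so linearity in the parameter passes through termwise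
-- and bilinearity in `m`, `n` is not needed.
@[fun_prop]
theorem isLinearMap_sweedler_right (t : M ⊗[K] N) {f : Q → M → N → P}
    (hf : ∀ m n, IsLinearMap K fun q => f q m n) :
    IsLinearMap K fun q => sweedler K t fun m n => f q m n := by
  refine ⟨fun q r => ?_, fun c q => ?_⟩
  · simp only [sweedler, (hf _ _).map_add, Finset.sum_add_distrib]
  · simp only [sweedler, (hf _ _).map_smul, Finset.smul_sum]

end Linearity

/-! ### Rules for manipulating Sweedler sums. -/

section Calculus

/-- An interchange of finite sums, valid for any `f`. As a rewrite rule it would loop, so it is used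
with the four spaces prescribed: the types then fix which kind of sum moves outwards, and rewriting
reaches a normal form. -/
theorem sweedler_comm {K : Type*} [Field K] {M N Q R P : Type*} [AddCommGroup M] [Module K M]
    [AddCommGroup N] [Module K N] [AddCommGroup Q] [Module K Q] [AddCommGroup R] [Module K R]
    [AddCommGroup P] (t : M ⊗[K] N) (s : Q ⊗[K] R) (f : M → N → Q → R → P) :
    (sweedler K t fun m n => sweedler K s fun q r => f m n q r) =
      sweedler K s fun q r => sweedler K t fun m n => f m n q r := by
  simp only [sweedler]
  exact Finset.sum_comm

theorem sweedler_congr {K : Type*} [Field K] {M N P : Type*} [AddCommGroup M] [Module K M]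
    [AddCommGroup N] [Module K N] [AddCommGroup P] {t : M ⊗[K] N} {f g : M → N → P}
    (h : ∀ m n, f m n = g m n) : sweedler K t f = sweedler K t g := by
  rw [show f = g from funext fun m => funext (h m)]

variable {K : Type*} [Field K] {M N P Q R : Type*} [AddCommGroup M] [Module K M]
  [AddCommGroup N] [Module K N] [AddCommGroup P] [Module K P] [AddCommGroup Q] [Module K Q]
  [AddCommGroup R] [Module K R]

theorem map_sweedler (F : P →ₗ[K] Q) (t : M ⊗[K] N) (f : M → N → P) :
    F (sweedler K t f) = sweedler K t fun m n => F (f m n) := by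
  simp only [sweedler, map_sum]

theorem equiv_sweedler (F : P ≃ₗ[K] Q) (t : M ⊗[K] N) (f : M → N → P) :
    F (sweedler K t f) = sweedler K t fun m n => F (f m n) := by
  simp only [sweedler, map_sum]

theorem sweedler_mul {A : Type*} [Ring A] (t : M ⊗[K] N) (f : M → N → A) (a : A) :
    sweedler K t f * a = sweedler K t fun m n => f m n * a := by
  simp only [sweedler, Finset.sum_mul]

theorem mul_sweedler {A : Type*} [Ring A] (t : M ⊗[K] N) (f : M → N → A) (a : A) :
    a * sweedler K t f = sweedler K t fun m n => a * f m n := by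
  simp only [sweedler, Finset.mul_sum]

theorem sweedler_tmul (t : M ⊗[K] N) (f : M → N → P) (q : Q) :
    sweedler K t f ⊗ₜ[K] q = sweedler K t fun m n => f m n ⊗ₜ[K] q := by
  simp only [sweedler, TensorProduct.sum_tmul]

theorem tmul_sweedler (t : M ⊗[K] N) (f : M → N → P) (q : Q) :
    q ⊗ₜ[K] sweedler K t f = sweedler K t fun m n => q ⊗ₜ[K] f m n := by
  simp only [sweedler, TensorProduct.tmul_sum]

theorem sweedler_smul (t : M ⊗[K] N) (c : K) (f : M → N → P) :
    (sweedler K t fun m n => c • f m n) = c • sweedler K t f := by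
  simp only [sweedler, Finset.smul_sum]

/-- Here bilinearity is essential: the chosen presentation of `m ⊗ n` need not be the one-term one.
-/
theorem sweedler_of_tmul {f : M → N → P} (m : M) (n : N)
    (hl : ∀ n, IsLinearMap K fun m => f m n) (hr : ∀ m, IsLinearMap K fun n => f m n) :
    sweedler K (m ⊗ₜ[K] n) f = f m n := by
  rw [sweedler_eq_lift_mk _ f hl hr, TensorProduct.lift.tmul, LinearMap.mk₂_apply]

theorem sweedler_sweedler (s : Q ⊗[K] R) (g : Q → R → M ⊗[K] N) {f : M → N → P}
    (hl : ∀ n, IsLinearMap K fun m => f m n) (hr : ∀ m, IsLinearMap K fun n => f m n) :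
    sweedler K (sweedler K s g) f = sweedler K s fun q r => sweedler K (g q r) f := by
  simp only [sweedler_eq_lift_mk _ f hl hr, map_sweedler]

theorem sweedler_of_smul (c : K) (t : M ⊗[K] N) {f : M → N → P}
    (hl : ∀ n, IsLinearMap K fun m => f m n) (hr : ∀ m, IsLinearMap K fun n => f m n) :
    sweedler K (c • t) f = c • sweedler K t f := by
  simp only [sweedler_eq_lift_mk _ f hl hr, map_smul]

theorem sweedler_tmul_self (t : M ⊗[K] N) : (sweedler K t fun m n => m ⊗ₜ[K] n) = t := by
  conv_rhs => rw [(TensorProduct.exists_finset t).choose_spec]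
  rfl

theorem rTensor_eq_sweedler (g : M →ₗ[K] P) (t : M ⊗[K] N) :
    g.rTensor N t = sweedler K t fun m n => g m ⊗ₜ[K] n := by
  conv_lhs => rw [← sweedler_tmul_self t]
  simp only [map_sweedler, LinearMap.rTensor_tmul]

theorem lTensor_eq_sweedler (g : N →ₗ[K] P) (t : M ⊗[K] N) :
    g.lTensor M t = sweedler K t fun m n => m ⊗ₜ[K] g n := by
  conv_lhs => rw [← sweedler_tmul_self t]
  simp only [map_sweedler, LinearMap.lTensor_tmul]

theorem assoc_tmul_eq_sweedler (t : M ⊗[K] N) (p : P) :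
    TensorProduct.assoc K M N P (t ⊗ₜ[K] p) = sweedler K t fun m n => m ⊗ₜ[K] (n ⊗ₜ[K] p) := by
  conv_lhs => rw [← sweedler_tmul_self t]
  simp only [sweedler_tmul, equiv_sweedler, TensorProduct.assoc_tmul]

/-- A coassociativity law, evaluated under a trilinear map. -/
theorem sweedler_of_coassoc {C D E : Type*} [AddCommGroup C] [Module K C] [AddCommGroup D]
    [Module K D] [AddCommGroup E] [Module K E] {t : M ⊗[K] C} {s : D ⊗[K] N}
    {α : M →ₗ[K] D ⊗[K] E} {β : N →ₗ[K] E ⊗[K] C}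
    (h : TensorProduct.assoc K D E C (α.rTensor C t) = β.lTensor D s)
    {f : D → E → C → P} (h₁ : ∀ e c, IsLinearMap K fun d => f d e c)
    (h₂ : ∀ d c, IsLinearMap K fun e => f d e c) (h₃ : ∀ d e, IsLinearMap K fun c => f d e c) :
    (sweedler K t fun m c => sweedler K (α m) fun d e => f d e c) =
      sweedler K s fun d n => sweedler K (β n) fun e c => f d e c := by
  have := congrArg (fun X => sweedler K X fun d ec => sweedler K ec fun e c => f d e c) h
  simpa (disch := fun_prop) only [rTensor_eq_sweedler, lTensor_eq_sweedler, equiv_sweedler,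
    assoc_tmul_eq_sweedler, sweedler_sweedler, sweedler_of_tmul] using this

/-- A left counit law, evaluated under a linear map. -/
theorem sweedler_of_counit_left {t : M ⊗[K] N} {ε : M →ₗ[K] K} {n : N}
    (h : ε.rTensor N t = 1 ⊗ₜ[K] n) {f : N → P} (hf : IsLinearMap K f) :
    (sweedler K t fun m n => ε m • f n) = f n := by
  have := congrArg (fun X => sweedler K X fun c n => c • f n) h
  simpa (disch := fun_prop) only [rTensor_eq_sweedler, sweedler_sweedler, sweedler_of_tmul,
    one_smul] using this

/-- A right counit law, evaluated under a linear map. -/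
theorem sweedler_of_counit_right {t : M ⊗[K] N} {ε : N →ₗ[K] K} {m : M}
    (h : ε.lTensor M t = m ⊗ₜ[K] 1) {f : M → P} (hf : IsLinearMap K f) :
    (sweedler K t fun m n => ε n • f m) = f m := by
  have := congrArg (fun X => sweedler K X fun m c => c • f m) h
  simpa (disch := fun_prop) only [lTensor_eq_sweedler, sweedler_sweedler, sweedler_of_tmul,
    one_smul] using this

end Calculus

/-! ### Coalgebra, comodule coalgebra and bialgebra axioms under multilinear maps. -/

section Coalgebra

variable {K : Type*} [Field K] {P : Type*} [AddCommGroup P] [Module K P]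
  {C : Type*} [AddCommGroup C] [Module K C] [Coalgebra K C]

theorem sweedler_coassoc (x : C) {f : C → C → C → P}
    (h₁ : ∀ e c, IsLinearMap K fun d => f d e c)
    (h₂ : ∀ d c, IsLinearMap K fun e => f d e c) (h₃ : ∀ d e, IsLinearMap K fun c => f d e c) :
    (sweedler K (comul x) fun u v => sweedler K (comul u) fun p q => f p q v) =
      sweedler K (comul x) fun p u => sweedler K (comul u) fun q v => f p q v :=
  sweedler_of_coassoc (Coalgebra.coassoc_apply x) h₁ h₂ h₃

theorem sweedler_counit_left (x : C) {f : C → P} (hf : IsLinearMap K f) :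
    (sweedler K (comul x) fun u v => counit (R := K) u • f v) = f x :=
  sweedler_of_counit_left (Coalgebra.rTensor_counit_comul x) hf

theorem sweedler_counit_right (x : C) {f : C → P} (hf : IsLinearMap K f) :
    (sweedler K (comul x) fun u v => counit (R := K) v • f u) = f x :=
  sweedler_of_counit_right (Coalgebra.lTensor_counit_comul x) hf

end Coalgebra

section Comodules

variable {K : Type*} [Field K] {H : Type*} [Ring H] [Bialgebra K H]
  {P : Type*} [AddCommGroup P] [Module K P]

section Left

variable {A : Type*} [AddCommGroup A] [Module K A] [Coalgebra K A] {ρ : A →ₗ[K] H ⊗[K] A}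

theorem IsLeftComoduleCoalgebra.sweedler_coassoc (hρ : IsLeftComoduleCoalgebra ρ) (a : A)
    {f : H → H → A → P} (h₁ : ∀ e c, IsLinearMap K fun d => f d e c)
    (h₂ : ∀ d c, IsLinearMap K fun e => f d e c) (h₃ : ∀ d e, IsLinearMap K fun c => f d e c) :
    (sweedler K (ρ a) fun h c => sweedler K (comul h) fun p q => f p q c) =
      sweedler K (ρ a) fun p b => sweedler K (ρ b) fun q c => f p q c :=
  sweedler_of_coassoc (hρ.coassoc a) h₁ h₂ h₃

theorem IsLeftComoduleCoalgebra.sweedler_counit (hρ : IsLeftComoduleCoalgebra ρ) (a : A)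
    {f : A → P} (hf : IsLinearMap K f) :
    (sweedler K (ρ a) fun h c => counit (R := K) h • f c) = f a :=
  sweedler_of_counit_left (hρ.counit_coact a) hf

theorem IsLeftComoduleCoalgebra.sweedler_counit_coalg (hρ : IsLeftComoduleCoalgebra ρ) (a : A)
    {f : H → P} (hf : IsLinearMap K f) :
    (sweedler K (ρ a) fun h c => counit (R := K) c • f h) = counit (R := K) a • f 1 := by
  have := congrArg hf.mk' (hρ.counit_coalg a)
  simpa only [map_sweedler, map_smul, IsLinearMap.mk'_apply] using this

theorem IsLeftComoduleCoalgebra.sweedler_comul (hρ : IsLeftComoduleCoalgebra ρ) (a : A)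
    {f : H → A → A → P} (h₁ : ∀ e c, IsLinearMap K fun d => f d e c)
    (h₂ : ∀ d c, IsLinearMap K fun e => f d e c) (h₃ : ∀ d e, IsLinearMap K fun c => f d e c) :
    (sweedler K (ρ a) fun h c => sweedler K (comul c) fun p q => f h p q) =
      sweedler K (comul a) fun a₁ a₂ => sweedler K (ρ a₁) fun h p => sweedler K (ρ a₂) fun k q =>
        f (h * k) p q := by
  have := congrArg (fun X => sweedler K X fun hp q => sweedler K hp fun h p => f h p q)
    (hρ.comul_coact a)
  simpa (disch := fun_prop) only [sweedler_sweedler, sweedler_of_tmul] using this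

end Left

section Right

variable {B : Type*} [AddCommGroup B] [Module K B] [Coalgebra K B] {ψ : B →ₗ[K] B ⊗[K] H}

theorem IsRightComoduleCoalgebra.sweedler_coassoc (hψ : IsRightComoduleCoalgebra ψ) (b : B)
    {f : B → H → H → P} (h₁ : ∀ e c, IsLinearMap K fun d => f d e c)
    (h₂ : ∀ d c, IsLinearMap K fun e => f d e c) (h₃ : ∀ d e, IsLinearMap K fun c => f d e c) :
    (sweedler K (ψ b) fun c k => sweedler K (comul k) fun p q => f c p q) =
      sweedler K (ψ b) fun c q => sweedler K (ψ c) fun d p => f d p q :=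
  (sweedler_of_coassoc (hψ.coassoc b) h₁ h₂ h₃).symm

theorem IsRightComoduleCoalgebra.sweedler_counit (hψ : IsRightComoduleCoalgebra ψ) (b : B)
    {f : B → P} (hf : IsLinearMap K f) :
    (sweedler K (ψ b) fun c k => counit (R := K) k • f c) = f b :=
  sweedler_of_counit_right (hψ.counit_coact b) hf

theorem IsRightComoduleCoalgebra.sweedler_counit_coalg (hψ : IsRightComoduleCoalgebra ψ) (b : B)
    {f : H → P} (hf : IsLinearMap K f) :
    (sweedler K (ψ b) fun c k => counit (R := K) c • f k) = counit (R := K) b • f 1 := by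
  have := congrArg hf.mk' (hψ.counit_coalg b)
  simpa only [map_sweedler, map_smul, IsLinearMap.mk'_apply] using this

theorem IsRightComoduleCoalgebra.sweedler_comul (hψ : IsRightComoduleCoalgebra ψ) (b : B)
    {f : B → B → H → P} (h₁ : ∀ e c, IsLinearMap K fun d => f d e c)
    (h₂ : ∀ d c, IsLinearMap K fun e => f d e c) (h₃ : ∀ d e, IsLinearMap K fun c => f d e c) :
    (sweedler K (ψ b) fun c h => sweedler K (comul c) fun p q => f p q h) =
      sweedler K (comul b) fun b₁ b₂ => sweedler K (ψ b₁) fun p h => sweedler K (ψ b₂) fun q k =>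
        f p q (h * k) := by
  have := congrArg (fun X => sweedler K X fun pq h => sweedler K pq fun p q => f p q h)
    (hψ.comul_coact b)
  simpa (disch := fun_prop) only [sweedler_sweedler, sweedler_of_tmul] using this

end Right

end Comodules

/-! ### Models of the crossed product and smash coproduct. -/

section Realization

variable {K : Type*} [Field K] {H : Type*} [Ring H] [Bialgebra K H]
  {A : Type*} [Ring A] [Algebra K A] [Coalgebra K A]
  {B : Type*} [Ring B] [Algebra K B] [Coalgebra K B]

/-- The trilinear map `τ` exhibits `W` as the vector space `A ⊗ H ⊗ B`, with the unit and product of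
`A #^σ H # B` and with the counit and coproduct of `A × H × B`. -/
structure IsRealization {W : Type*} [Ring W] [Algebra K W] [Coalgebra K W]
    (lact : H →ₗ[K] A →ₗ[K] A) (σ : H →ₗ[K] H →ₗ[K] A)
    (ρ : A →ₗ[K] H ⊗[K] A) (ract : B →ₗ[K] H →ₗ[K] B) (ψ : B →ₗ[K] B ⊗[K] H)
    (τ : A →ₗ[K] H →ₗ[K] B →ₗ[K] W) : Prop where
  induction : ∀ {p : W → Prop}, (∀ a x b, p (τ a x b)) → (∀ u v, p u → p v → p (u + v)) → ∀ w, p w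
  one : τ 1 1 1 = 1
  mul : ∀ (a a' : A) (x x' : H) (b b' : B), τ a x b * τ a' x' b' =
    sweedler K (comul x) fun x₁ y => sweedler K (comul y) fun x₂ x₃ =>
      sweedler K (comul x') fun x'₁ y' => sweedler K (comul y') fun x'₂ x'₃ =>
        τ (a * lact x₁ a' * σ x₂ x'₁) (x₃ * x'₂) (ract b x'₃ * b')
  comul_apply : ∀ (a : A) (x : H) (b : B), comul (R := K) (τ a x b) =
    sweedler K (comul a) fun a₁ a₂ => sweedler K (ρ a₂) fun h a₂₀ =>
      sweedler K (comul x) fun x₁ x₂ =>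
        sweedler K (comul b) fun b₁ b₂ => sweedler K (ψ b₁) fun b₁₀ k =>
          τ a₁ (h * x₁) b₁₀ ⊗ₜ[K] τ a₂₀ (x₂ * k) b₂
  counit_apply : ∀ (a : A) (x : H) (b : B), counit (R := K) (τ a x b) =
    counit (R := K) a * counit (R := K) x * counit (R := K) b

end Realization

section Bialgebra

variable {K : Type*} [Field K] {H : Type*} [Ring H] [Bialgebra K H]
  {P : Type*} [AddCommGroup P] [Module K P]

theorem comul_one_eq_tmul : comul (R := K) (1 : H) = (1 : H) ⊗ₜ[K] (1 : H) :=
  Bialgebra.comul_one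

theorem sweedler_comul_mul (x y : H) {f : H → H → P} (h₁ : ∀ v, IsLinearMap K fun u => f u v)
    (h₂ : ∀ u, IsLinearMap K fun v => f u v) :
    sweedler K (comul (x * y)) f = sweedler K (comul x) fun x₁ x₂ =>
      sweedler K (comul y) fun y₁ y₂ => f (x₁ * y₁) (x₂ * y₂) := by
  have key : (comul (R := K) (x * y)) = sweedler K (comul x) fun x₁ x₂ =>
      sweedler K (comul y) fun y₁ y₂ => (x₁ * y₁) ⊗ₜ[K] (x₂ * y₂) := by
    rw [Bialgebra.comul_mul]
    conv_lhs => rw [← sweedler_tmul_self (comul x), ← sweedler_tmul_self (comul y)]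
    simp only [sweedler_mul, mul_sweedler, Algebra.TensorProduct.tmul_mul_tmul]
    exact sweedler_comm _ _ _
  rw [key]
  simp (disch := fun_prop) only [sweedler_sweedler, sweedler_of_tmul]

/-- Two bracketings of the fourfold coproduct. -/
theorem sweedler_coassoc₄ (x : H) {f : H → H → H → H → P}
    (h₁ : ∀ q r s, IsLinearMap K fun p => f p q r s)
    (h₂ : ∀ p r s, IsLinearMap K fun q => f p q r s)
    (h₃ : ∀ p q s, IsLinearMap K fun r => f p q r s)
    (h₄ : ∀ p q r, IsLinearMap K fun s => f p q r s) :
    (sweedler K (comul x) fun u v => sweedler K (comul u) fun p q => sweedler K (comul v) fun r s =>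
      f p q r s) =
    sweedler K (comul x) fun p u => sweedler K (comul u) fun v s => sweedler K (comul v) fun q r =>
      f p q r s := by
  rw [sweedler_coassoc x]
  · refine sweedler_congr fun p u => ?_
    exact (sweedler_coassoc u (by fun_prop) (by fun_prop) (by fun_prop)).symm
  all_goals fun_prop

end Bialgebra

/-! ### Standing hypotheses, and the compatibility conditions under multilinear maps. -/

section Setting

variable {K : Type*} [Field K] {H : Type*} [Ring H] [Bialgebra K H]
  {A : Type*} [Ring A] [Algebra K A] [Coalgebra K A]
  {B : Type*} [Ring B] [Algebra K B] [Coalgebra K B]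

/-- The standing hypotheses on the structure maps. -/
structure IsSetting (lact : H →ₗ[K] A →ₗ[K] A) (σ : H →ₗ[K] H →ₗ[K] A)
    (ρ : A →ₗ[K] H ⊗[K] A) (ract : B →ₗ[K] H →ₗ[K] B) (ψ : B →ₗ[K] B ⊗[K] H) : Prop where
  counit_one_left : counit (R := K) (1 : A) = 1
  counit_one_right : counit (R := K) (1 : B) = 1
  counit_cocycle : ∀ x x' : H,
    counit (R := K) (σ x x') = counit (R := K) x * counit (R := K) x'
  coact_left : IsLeftComoduleCoalgebra ρ
  act_left : IsLeftWeakAction lact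
  cocycle : IsCrossedCocycle lact σ
  act_right : IsRightModuleAlgebra ract
  coact_right : IsRightComoduleCoalgebra ψ

variable {lact : H →ₗ[K] A →ₗ[K] A} {σ : H →ₗ[K] H →ₗ[K] A}
  {ρ : A →ₗ[K] H ⊗[K] A} {ract : B →ₗ[K] H →ₗ[K] B} {ψ : B →ₗ[K] B ⊗[K] H}

theorem IsSetting.one_laws (hs : IsSetting lact σ ρ ract ψ) :
    (∀ x : H, ract 1 x = counit (R := K) x • (1 : B)) ∧ (∀ b, ract b 1 = b) ∧
      (∀ a, lact 1 a = a) ∧ (∀ x : H, lact x 1 = counit (R := K) x • (1 : A)) ∧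
      (∀ x : H, σ x 1 = counit (R := K) x • (1 : A)) ∧
      ∀ x : H, σ 1 x = counit (R := K) x • (1 : A) :=
  ⟨hs.act_right.one_act, hs.act_right.act_one, hs.act_left.one_act, hs.act_left.act_one,
    hs.cocycle.right_one, hs.cocycle.left_one⟩

/-- The part of the compatibility conditions concerning units and counits. -/
structure IsNormalized (lact : H →ₗ[K] A →ₗ[K] A) (ρ : A →ₗ[K] H ⊗[K] A)
    (ract : B →ₗ[K] H →ₗ[K] B) (ψ : B →ₗ[K] B ⊗[K] H) : Prop where
  counit_mul_left : ∀ a a' : A,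
    counit (R := K) (a * a') = counit (R := K) a * counit (R := K) a'
  counit_mul_right : ∀ b b' : B,
    counit (R := K) (b * b') = counit (R := K) b * counit (R := K) b'
  comul_one_left : comul (R := K) (1 : A) = (1 : A) ⊗ₜ[K] (1 : A)
  comul_one_right : comul (R := K) (1 : B) = (1 : B) ⊗ₜ[K] (1 : B)
  coact_one_left : ρ 1 = (1 : H) ⊗ₜ[K] (1 : A)
  coact_one_right : ψ 1 = (1 : B) ⊗ₜ[K] (1 : H)
  counit_act_left : ∀ (x : H) (a : A),
    counit (R := K) (lact x a) = counit (R := K) a * counit (R := K) x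
  counit_act_right : ∀ (b : B) (x : H),
    counit (R := K) (ract b x) = counit (R := K) b * counit (R := K) x

theorem IsNormalized.one_laws (hn : IsNormalized lact ρ ract ψ) :
    comul (R := K) (1 : A) = (1 : A) ⊗ₜ[K] (1 : A) ∧
      comul (R := K) (1 : B) = (1 : B) ⊗ₜ[K] (1 : B) ∧
      ρ 1 = (1 : H) ⊗ₜ[K] (1 : A) ∧ ψ 1 = (1 : B) ⊗ₜ[K] (1 : H) :=
  ⟨hn.comul_one_left, hn.comul_one_right, hn.coact_one_left, hn.coact_one_right⟩

theorem IsSetting.counit_laws (hs : IsSetting lact σ ρ ract ψ) :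
    counit (R := K) (1 : A) = 1 ∧ counit (R := K) (1 : B) = 1 ∧
      ∀ x x' : H, counit (R := K) (σ x x') = counit (R := K) x * counit (R := K) x' :=
  ⟨hs.counit_one_left, hs.counit_one_right, hs.counit_cocycle⟩

theorem IsNormalized.counit_laws (hn : IsNormalized lact ρ ract ψ) :
    (∀ a a' : A, counit (R := K) (a * a') = counit (R := K) a * counit (R := K) a') ∧
      (∀ b b' : B, counit (R := K) (b * b') = counit (R := K) b * counit (R := K) b') ∧
      (∀ (x : H) (a : A), counit (R := K) (lact x a) = counit (R := K) a * counit (R := K) x) ∧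
      ∀ (b : B) (x : H), counit (R := K) (ract b x) = counit (R := K) b * counit (R := K) x :=
  ⟨hn.counit_mul_left, hn.counit_mul_right, hn.counit_act_left, hn.counit_act_right⟩

/-- Only (D20) is assumed, not the whole list of conditions, because the proof of necessity uses
this on the way to (E3). The same holds for (D21) in the next lemma. -/
theorem sweedler_of_cocycle_coact_right {b : B} {x : H} {P : Type*} [AddCommGroup P] [Module K P]
    (h : (sweedler K (ψ b) fun b₀ k => b₀ ⊗ₜ[K] (1 : A) ⊗ₜ[K] (x * k)) =
      sweedler K (ψ b) fun b₀ k => sweedler K (comul k) fun k₁ k₂ =>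
        sweedler K (comul x) fun x₁ x₂ => b₀ ⊗ₜ[K] σ x₁ k₁ ⊗ₜ[K] (x₂ * k₂))
    {f : B → A → H → P} (h₁ : ∀ a y, IsLinearMap K fun b => f b a y)
    (h₂ : ∀ b y, IsLinearMap K fun a => f b a y) (h₃ : ∀ b a, IsLinearMap K fun y => f b a y) :
    (sweedler K (ψ b) fun b₀ k => f b₀ 1 (x * k)) =
    sweedler K (ψ b) fun b₀ k => sweedler K (comul k) fun k₁ k₂ =>
      sweedler K (comul x) fun x₁ x₂ => f b₀ (σ x₁ k₁) (x₂ * k₂) := by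
  have := congrArg (fun X => sweedler K X fun ba y => sweedler K ba fun b a => f b a y) h
  simpa (disch := fun_prop) only [sweedler_sweedler, sweedler_of_tmul] using this

theorem sweedler_of_double_biproduct {a : A} {b : B} {P : Type*} [AddCommGroup P] [Module K P]
    (h : (sweedler K (ρ a) fun h a₀ => sweedler K (ψ b) fun b₀ k => lact k a₀ ⊗ₜ[K] ract b₀ h) =
      a ⊗ₜ[K] b)
    {f : A → B → P} (h₁ : ∀ b, IsLinearMap K fun a => f a b)
    (h₂ : ∀ a, IsLinearMap K fun b => f a b) :
    (sweedler K (ρ a) fun h a₀ => sweedler K (ψ b) fun b₀ k => f (lact k a₀) (ract b₀ h)) =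
      f a b := by
  have := congrArg (fun X => sweedler K X f) h
  simpa (disch := fun_prop) only [sweedler_sweedler, sweedler_of_tmul] using this

namespace BiproductConditions

theorem isNormalized (h : BiproductConditions lact σ ρ ract ψ) : IsNormalized lact ρ ract ψ where
  counit_mul_left := h.counit_alg_left.2
  counit_mul_right := h.counit_alg_right.2
  comul_one_left := h.comul_one_left
  comul_one_right := h.comul_one_right
  coact_one_left := h.coact_one_left
  coact_one_right := h.coact_one_right
  counit_act_left := h.counit_act_left
  counit_act_right := h.counit_act_right

variable {P : Type*} [AddCommGroup P] [Module K P]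

theorem sweedler_twisted_comodule_cocycle (h : BiproductConditions lact σ ρ ract ψ) (a : A) (x : H)
    {f : A → H → A → P} (h₁ : ∀ y c, IsLinearMap K fun a => f a y c)
    (h₂ : ∀ a c, IsLinearMap K fun y => f a y c) (h₃ : ∀ a y, IsLinearMap K fun c => f a y c) :
    (sweedler K (comul a) fun a₁ a₂ => sweedler K (ρ a₂) fun h a₂₀ => f a₁ (h * x) a₂₀) =
    sweedler K (comul a) fun a₁ a₂ => sweedler K (ρ a₂) fun h a₂₀ =>
      sweedler K (comul h) fun h₁ h₂ => sweedler K (comul x) fun x₁ x₂ =>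
        f (a₁ * σ h₁ x₁) (h₂ * x₂) a₂₀ := by
  have := congrArg (fun X => sweedler K X fun ay c => sweedler K ay fun a y => f a y c)
    (h.twisted_comodule_cocycle a x)
  simpa (disch := fun_prop) only [sweedler_sweedler, sweedler_of_tmul] using this

theorem sweedler_coact_cocycle (h : BiproductConditions lact σ ρ ract ψ) (x x' : H)
    {f : H → A → P} (h₁ : ∀ a, IsLinearMap K fun y => f y a)
    (h₂ : ∀ y, IsLinearMap K fun a => f y a) :
    (sweedler K (comul x) fun x₁ x₂ => sweedler K (comul x') fun x'₁ x'₂ =>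
      sweedler K (ρ (σ x₁ x'₁)) fun h s₀ => f (h * x₂ * x'₂) s₀) =
    sweedler K (comul x) fun x₁ x₂ => sweedler K (comul x') fun x'₁ x'₂ =>
      f (x₁ * x'₁) (σ x₂ x'₂) := by
  have := congrArg (fun X => sweedler K X f) (h.coact_cocycle x x')
  simpa (disch := fun_prop) only [sweedler_sweedler, sweedler_of_tmul] using this

theorem sweedler_yetterDrinfeld_left (h : BiproductConditions lact σ ρ ract ψ) (x : H) (a : A)
    {f : H → A → P} (h₁ : ∀ a, IsLinearMap K fun y => f y a)
    (h₂ : ∀ y, IsLinearMap K fun a => f y a) :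
    (sweedler K (comul x) fun x₁ x₂ => sweedler K (ρ (lact x₁ a)) fun h c₀ => f (h * x₂) c₀) =
    sweedler K (comul x) fun x₁ x₂ => sweedler K (ρ a) fun h a₀ => f (x₁ * h) (lact x₂ a₀) := by
  have := congrArg (fun X => sweedler K X f) (h.yetterDrinfeld_left x a)
  simpa (disch := fun_prop) only [sweedler_sweedler, sweedler_of_tmul] using this

theorem sweedler_yetterDrinfeld_right (h : BiproductConditions lact σ ρ ract ψ) (b : B) (x : H)
    {f : B → H → P} (h₁ : ∀ y, IsLinearMap K fun b => f b y)
    (h₂ : ∀ b, IsLinearMap K fun y => f b y) :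
    (sweedler K (comul x) fun x₁ x₂ => sweedler K (ψ (ract b x₂)) fun c₀ k => f c₀ (x₁ * k)) =
    sweedler K (comul x) fun x₁ x₂ => sweedler K (ψ b) fun b₀ k => f (ract b₀ x₁) (k * x₂) := by
  have := congrArg (fun X => sweedler K X f) (h.yetterDrinfeld_right b x)
  simpa (disch := fun_prop) only [sweedler_sweedler, sweedler_of_tmul] using this

theorem sweedler_cocycle_coact_right (h : BiproductConditions lact σ ρ ract ψ) (b : B) (x : H)
    {f : B → A → H → P} (h₁ : ∀ a y, IsLinearMap K fun b => f b a y)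
    (h₂ : ∀ b y, IsLinearMap K fun a => f b a y) (h₃ : ∀ b a, IsLinearMap K fun y => f b a y) :
    (sweedler K (ψ b) fun b₀ k => f b₀ 1 (x * k)) =
    sweedler K (ψ b) fun b₀ k => sweedler K (comul k) fun k₁ k₂ =>
      sweedler K (comul x) fun x₁ x₂ => f b₀ (σ x₁ k₁) (x₂ * k₂) :=
  sweedler_of_cocycle_coact_right (h.cocycle_coact_right b x) h₁ h₂ h₃

theorem sweedler_double_biproduct (h : BiproductConditions lact σ ρ ract ψ) (a : A) (b : B)
    {f : A → B → P} (h₁ : ∀ b, IsLinearMap K fun a => f a b)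
    (h₂ : ∀ a, IsLinearMap K fun b => f a b) :
    (sweedler K (ρ a) fun h a₀ => sweedler K (ψ b) fun b₀ k => f (lact k a₀) (ract b₀ h)) =
      f a b :=
  sweedler_of_double_biproduct (h.double_biproduct a b) h₁ h₂

/-- The case `a = 1`, `x = 1` of (E3), where the weak action and the left-hand cocycle become
trivial. Sufficiency uses (E3) only through two further specialisations of this identity. -/
theorem sweedler_cocycle_act_coact (h : BiproductConditions lact σ ρ ract ψ)
    (hs : IsSetting lact σ ρ ract ψ)
    (x : H) (b b' : B) {f : B → A → P} (h₁ : ∀ a, IsLinearMap K fun b => f b a)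
    (h₂ : ∀ b, IsLinearMap K fun a => f b a) :
    f (ract b x * b') 1 = sweedler K (comul x) fun x₁ x₂ =>
      sweedler K (ψ b) fun b₀ k => sweedler K (ψ b') fun b'₀ k' =>
        f (ract b₀ x₁ * b'₀) (σ k (x₂ * k')) := by
  have := congrArg (fun X => sweedler K X f) (h.cocycle_act_coact 1 1 x b b')
  simpa (disch := fun_prop) only [sweedler_sweedler, sweedler_of_tmul, Bialgebra.comul_one,
    Algebra.TensorProduct.one_def, hs.act_left.one_act, hs.cocycle.left_one, mul_smul_comm, one_mul,
    mul_one, TensorProduct.tmul_smul, sweedler_counit_left, sweedler_of_smul] using this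

/-- The case `x = 1` of `sweedler_cocycle_act_coact`. -/
theorem sweedler_cocycle_coact_coact (h : BiproductConditions lact σ ρ ract ψ)
    (hs : IsSetting lact σ ρ ract ψ)
    (b b' : B) {f : B → A → P} (h₁ : ∀ a, IsLinearMap K fun b => f b a)
    (h₂ : ∀ b, IsLinearMap K fun a => f b a) :
    f (b * b') 1 = sweedler K (ψ b) fun b₀ k => sweedler K (ψ b') fun b'₀ k' =>
        f (b₀ * b'₀) (σ k k') := by
  have := h.sweedler_cocycle_act_coact hs 1 b b' h₁ h₂
  simpa (disch := fun_prop) only [sweedler_of_tmul, Bialgebra.comul_one,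
    Algebra.TensorProduct.one_def, hs.act_right.act_one, one_mul] using this

/-- The case `b' = 1` of `sweedler_cocycle_act_coact`. -/
theorem sweedler_cocycle_act (h : BiproductConditions lact σ ρ ract ψ)
    (hs : IsSetting lact σ ρ ract ψ)
    (x : H) (b : B) {f : B → A → P} (h₁ : ∀ a, IsLinearMap K fun b => f b a)
    (h₂ : ∀ b, IsLinearMap K fun a => f b a) :
    f (ract b x) 1 = sweedler K (comul x) fun x₁ x₂ =>
      sweedler K (ψ b) fun b₀ k => f (ract b₀ x₁) (σ k x₂) := by
  have := h.sweedler_cocycle_act_coact hs x b 1 h₁ h₂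
  simpa (disch := fun_prop) only [sweedler_of_tmul, h.coact_one_right, mul_one] using this

end BiproductConditions

end Setting

/-! ### Multiplicativity of the coproduct on pairs of generators. -/

section Multiplicativity

variable {K : Type*} [Field K] {H : Type*} [Ring H] [Bialgebra K H]
  {A : Type*} [Ring A] [Algebra K A] [Coalgebra K A]
  {B : Type*} [Ring B] [Algebra K B] [Coalgebra K B]
  {W : Type*} [Ring W] [Algebra K W] [Coalgebra K W]
  {lact : H →ₗ[K] A →ₗ[K] A} {σ : H →ₗ[K] H →ₗ[K] A}
  {ρ : A →ₗ[K] H ⊗[K] A} {ract : B →ₗ[K] H →ₗ[K] B} {ψ : B →ₗ[K] B ⊗[K] H}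
  {τ : A →ₗ[K] H →ₗ[K] B →ₗ[K] W}

variable (K) in
/-- The comultiplication preserves the product of `u` and `v`. -/
def ComulMul (u v : W) : Prop :=
  comul (R := K) (u * v) = comul (R := K) u * comul (R := K) v

theorem IsRealization.comul_left (he : IsRealization lact σ ρ ract ψ τ)
    (hn : IsNormalized lact ρ ract ψ) (a : A) : comul (R := K) (τ a 1 1) =
      sweedler K (comul a) fun a₁ a₂ => sweedler K (ρ a₂) fun h a₂₀ =>
        τ a₁ h 1 ⊗ₜ[K] τ a₂₀ 1 1 := by
  simp (disch := fun_prop) only [he.comul_apply, comul_one_eq_tmul, hn.one_laws, sweedler_of_tmul,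
    mul_one]

theorem IsRealization.comul_mid (he : IsRealization lact σ ρ ract ψ τ)
    (hn : IsNormalized lact ρ ract ψ) (x : H) : comul (R := K) (τ 1 x 1) =
      sweedler K (comul x) fun x₁ x₂ => τ 1 x₁ 1 ⊗ₜ[K] τ 1 x₂ 1 := by
  simp (disch := fun_prop) only [he.comul_apply, hn.one_laws, sweedler_of_tmul, one_mul, mul_one]

theorem IsRealization.comul_right (he : IsRealization lact σ ρ ract ψ τ)
    (hn : IsNormalized lact ρ ract ψ) (b : B) : comul (R := K) (τ 1 1 b) =
      sweedler K (comul b) fun b₁ b₂ => sweedler K (ψ b₁) fun b₁₀ k =>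
        τ 1 1 b₁₀ ⊗ₜ[K] τ 1 k b₂ := by
  simp (disch := fun_prop) only [he.comul_apply, comul_one_eq_tmul, hn.one_laws, sweedler_of_tmul,
    one_mul]

theorem IsRealization.comul_mid_right (he : IsRealization lact σ ρ ract ψ τ)
    (hn : IsNormalized lact ρ ract ψ) (x : H) (b : B) : comul (R := K) (τ 1 x b) =
      sweedler K (comul x) fun x₁ x₂ => sweedler K (comul b) fun b₁ b₂ =>
        sweedler K (ψ b₁) fun b₁₀ k => τ 1 x₁ b₁₀ ⊗ₜ[K] τ 1 (x₂ * k) b₂ := by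
  simp (disch := fun_prop) only [he.comul_apply, hn.one_laws, sweedler_of_tmul, one_mul]

/-- The product is `a ⊗ x ⊗ b` itself. Multiplying the coproducts inserts `σ(a₂₋₁₁, x₁)` in the
first tensor factor, and (C5) removes it. -/
theorem comulMul_left_right (he : IsRealization lact σ ρ ract ψ τ)
    (hs : IsSetting lact σ ρ ract ψ) (h : BiproductConditions lact σ ρ ract ψ)
    (a : A) (x : H) (b : B) : ComulMul K (τ a 1 1) (τ 1 x b) := by
  have hn := h.isNormalized
  simp only [ComulMul, he.comul_left hn, he.comul_mid_right hn, sweedler_mul]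
  simp only [mul_sweedler, Algebra.TensorProduct.tmul_mul_tmul]
  simp (disch := fun_prop) only [he.mul, he.comul_apply, sweedler_tmul, sweedler_of_tmul,
    comul_one_eq_tmul, hs.one_laws, Bialgebra.counit_one, one_mul, mul_one, one_smul, mul_smul_comm,
    smul_mul_assoc, map_smul, LinearMap.smul_apply, sweedler_smul, sweedler_counit_left,
    sweedler_counit_right]
  simp only [sweedler_comm (M := A) (N := A) (Q := H) (R := H),
    sweedler_comm (M := H) (N := A) (Q := H) (R := H),
    sweedler_comm (M := A) (N := A) (Q := B) (R := B),
    sweedler_comm (M := H) (N := A) (Q := B) (R := B),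
    sweedler_comm (M := A) (N := A) (Q := B) (R := H),
    sweedler_comm (M := H) (N := A) (Q := B) (R := H)]
  refine sweedler_congr fun x₁ x₂ => sweedler_congr fun b₁ b₂ => sweedler_congr fun b₁₀ k => ?_
  exact h.sweedler_twisted_comodule_cocycle a x₁ (f := fun a y c =>
    τ a y b₁₀ ⊗ₜ[K] τ c (x₂ * k) b₂) (by fun_prop) (by fun_prop) (by fun_prop)

/-- Multiplying the coproducts inserts a cocycle between `x₂` and `b₁₍₁₎` in the second tensor
factor, and (D20) removes it. -/
theorem comulMul_mid_right (he : IsRealization lact σ ρ ract ψ τ)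
    (hs : IsSetting lact σ ρ ract ψ) (h : BiproductConditions lact σ ρ ract ψ)
    (x : H) (b : B) : ComulMul K (τ 1 x 1) (τ 1 1 b) := by
  have hn := h.isNormalized
  simp only [ComulMul, he.comul_mid hn, he.comul_right hn, sweedler_mul]
  simp only [mul_sweedler, Algebra.TensorProduct.tmul_mul_tmul]
  simp (disch := fun_prop) only [he.mul, he.comul_apply, sweedler_of_tmul, comul_one_eq_tmul,
    hn.one_laws, hs.one_laws, one_mul, mul_one, mul_smul_comm, smul_mul_assoc, map_smul,
    LinearMap.smul_apply, sweedler_smul, sweedler_counit_left, sweedler_counit_right]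
  simp only [tmul_sweedler]
  refine sweedler_congr fun x₁ x₂ => sweedler_congr fun b₁ b₂ => ?_
  refine Eq.trans ?_ (sweedler_congr fun _ _ => sweedler_comm _ _ _)
  exact h.sweedler_cocycle_coact_right b₁ x₂ (f := fun b a y => τ 1 x₁ b ⊗ₜ[K] τ a y b₂)
    (by fun_prop) (by fun_prop) (by fun_prop)

/-- Expand `Δ(aa')` by (D7) and the coaction on `a₂₀ a'₂₀` by (D8). Coassociativity of the coaction
then matches the two sides. -/
theorem comulMul_left_left (he : IsRealization lact σ ρ ract ψ τ)
    (hs : IsSetting lact σ ρ ract ψ) (h : BiproductConditions lact σ ρ ract ψ)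
    (a a' : A) : ComulMul K (τ a 1 1) (τ a' 1 1) := by
  have hn := h.isNormalized
  simp only [ComulMul, he.comul_left hn, sweedler_mul]
  simp only [mul_sweedler, Algebra.TensorProduct.tmul_mul_tmul]
  simp (disch := fun_prop) only [he.mul, he.comul_apply, sweedler_tmul, h.comul_mul_left,
    h.coact_mul_left, sweedler_sweedler, sweedler_of_tmul, comul_one_eq_tmul, hn.one_laws,
    hs.one_laws, mul_one, mul_smul_comm, map_smul, LinearMap.smul_apply, sweedler_counit_left,
    sweedler_counit_right]
  simp only [sweedler_comm (M := A) (N := A) (Q := H) (R := H),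
    sweedler_comm (M := H) (N := A) (Q := H) (R := H)]
  simp (disch := fun_prop) only [hs.coact_left.sweedler_coassoc]
  refine sweedler_congr fun a₁ a₂ => sweedler_congr fun h₁ c => sweedler_congr fun h₂ d => ?_
  rw [sweedler_comm]
  refine sweedler_congr fun a'₁ a'₂ => ?_
  rw [sweedler_comm]

/-- After (E1) and (D10), the product of coproducts differs from `Δ(bb')` only by a factor `σ(k,
k')` on the coaction legs of `b₁` and `b'₁`; the case `x = 1` of (E3) absorbs it. -/
theorem comulMul_right_right (he : IsRealization lact σ ρ ract ψ τ)
    (hs : IsSetting lact σ ρ ract ψ) (h : BiproductConditions lact σ ρ ract ψ)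
    (b b' : B) : ComulMul K (τ 1 1 b) (τ 1 1 b') := by
  have hn := h.isNormalized
  simp only [ComulMul, he.comul_right hn, sweedler_mul]
  simp only [mul_sweedler, Algebra.TensorProduct.tmul_mul_tmul]
  simp (disch := fun_prop) only [he.mul, he.comul_apply, h.comul_mul_right, h.coact_mul_right,
    sweedler_sweedler, sweedler_of_tmul, comul_one_eq_tmul, hn.one_laws, hs.one_laws,
    Bialgebra.counit_one, one_mul, mul_one, one_smul, mul_smul_comm, smul_mul_assoc, map_smul,
    LinearMap.smul_apply, sweedler_smul, sweedler_counit_left]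
  simp only [tmul_sweedler]
  simp only [sweedler_comm (M := B) (N := B) (Q := H) (R := H),
    sweedler_comm (M := B) (N := H) (Q := H) (R := H)]
  simp (disch := fun_prop) only [hs.coact_right.sweedler_coassoc]
  simp (disch := fun_prop) only [hs.coact_right.sweedler_coassoc,
    sweedler_comm (M := B) (N := H) (Q := H) (R := H)]
  refine sweedler_congr fun b₁ b₂ => ?_
  refine (sweedler_congr fun _ _ => sweedler_comm _ _ _).trans ?_
  rw [sweedler_comm]
  refine sweedler_congr fun c k => ?_
  rw [sweedler_comm]
  refine sweedler_congr fun b'₁ b'₂ => ?_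
  rw [sweedler_comm]
  refine sweedler_congr fun c' k' => ?_
  rw [sweedler_comm]
  refine sweedler_congr fun d l => ?_
  exact h.sweedler_cocycle_coact_coact hs c d (f := fun b a =>
    τ 1 1 b ⊗ₜ[K] τ a (k * l) (ract b₂ k' * b'₂)) (by fun_prop) (by fun_prop)

/-- By (D12), `Δ(xx')` becomes `σ(x₁, x'₁) ⊗ σ(x₂, x'₂)₋₁ x₃ x'₃ ⊗ σ(x₂, x'₂)₀ ⊗ x₄ x'₄` (the
trivial legs in `B` omitted), and (D11) applies to the two middle coproduct legs of `x` and `x'`. -/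
theorem comulMul_mid_mid (he : IsRealization lact σ ρ ract ψ τ)
    (hs : IsSetting lact σ ρ ract ψ) (h : BiproductConditions lact σ ρ ract ψ)
    (x x' : H) : ComulMul K (τ 1 x 1) (τ 1 x' 1) := by
  have hn := h.isNormalized
  simp only [ComulMul, he.comul_mid hn, sweedler_mul]
  simp only [mul_sweedler, Algebra.TensorProduct.tmul_mul_tmul]
  simp (disch := fun_prop) only [he.mul, he.comul_apply, map_sweedler, sweedler_tmul,
    h.comul_cocycle, sweedler_comul_mul, sweedler_sweedler, sweedler_of_tmul, hn.one_laws,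
    hs.one_laws, one_mul, mul_one, mul_smul_comm, smul_mul_assoc, map_smul, LinearMap.smul_apply,
    sweedler_smul, sweedler_counit_left, sweedler_counit_right]
  simp only [tmul_sweedler]
  refine Eq.trans (sweedler_congr fun _ _ => sweedler_congr fun _ _ => sweedler_congr fun _ _ =>
    sweedler_congr fun _ _ => sweedler_comm _ _ _) ?_
  refine Eq.trans (sweedler_congr fun _ _ => sweedler_congr fun _ _ => sweedler_congr fun _ _ =>
    sweedler_comm _ _ _) ?_
  refine Eq.trans (sweedler_congr fun _ _ => sweedler_comm _ _ _) ?_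
  refine Eq.trans (sweedler_congr fun _ _ => sweedler_congr fun _ _ => sweedler_comm _ _ _) ?_
  refine Eq.trans (sweedler_congr fun _ _ => sweedler_congr fun _ _ => sweedler_congr fun _ _ =>
    sweedler_congr fun _ _ => sweedler_congr fun _ _ => sweedler_comm _ _ _) ?_
  -- Rebracketing makes the second and third legs of `x`, and then of `x'`, the coproduct of a
  -- single element, as (D11) requires.
  refine Eq.trans (sweedler_coassoc₄ x ?_ ?_ ?_ ?_) ?_
  any_goals fun_prop
  refine Eq.trans (sweedler_congr fun _ _ => sweedler_congr fun _ _ => sweedler_congr fun _ _ =>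
    sweedler_coassoc₄ x' ?_ ?_ ?_ ?_) ?_
  any_goals fun_prop
  symm
  refine Eq.trans (sweedler_congr fun _ _ => sweedler_congr fun _ _ => sweedler_congr fun _ _ =>
    sweedler_comm _ _ _) ?_
  refine Eq.trans (sweedler_congr fun _ _ => sweedler_comm _ _ _) ?_
  refine Eq.trans (sweedler_congr fun _ _ => sweedler_congr fun _ _ => sweedler_comm _ _ _) ?_
  refine Eq.trans (sweedler_coassoc₄ x ?_ ?_ ?_ ?_) ?_
  any_goals fun_prop
  refine Eq.trans (sweedler_congr fun _ _ => sweedler_congr fun _ _ => sweedler_congr fun _ _ =>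
    sweedler_coassoc₄ x' ?_ ?_ ?_ ?_) ?_
  any_goals fun_prop
  symm
  refine sweedler_congr fun p u => sweedler_congr fun v s => ?_
  refine (sweedler_comm _ _ _).trans (Eq.trans ?_ (sweedler_comm _ _ _))
  refine sweedler_congr fun p' u' => ?_
  refine (sweedler_comm _ _ _).trans (Eq.trans ?_ (sweedler_comm _ _ _))
  refine sweedler_congr fun v' s' => ?_
  have key := h.sweedler_coact_cocycle v v' (f := fun y c =>
    τ (σ p p') y 1 ⊗ₜ[K] τ c (s * s') 1) (by fun_prop) (by fun_prop)
  simpa only [mul_assoc] using key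

/-- (D15) gives the coproduct of `x₁ ▷ a`; what remains is the coaction on `x₃ ▷ a₂₀` next to `x₄`,
which (D16) rewrites. -/
theorem comulMul_mid_left (he : IsRealization lact σ ρ ract ψ τ)
    (hs : IsSetting lact σ ρ ract ψ) (h : BiproductConditions lact σ ρ ract ψ)
    (x : H) (a : A) : ComulMul K (τ 1 x 1) (τ a 1 1) := by
  have hn := h.isNormalized
  simp only [ComulMul, he.comul_left hn, he.comul_mid hn, sweedler_mul]
  simp only [mul_sweedler, Algebra.TensorProduct.tmul_mul_tmul]
  simp (disch := fun_prop) only [he.mul, he.comul_apply, map_sweedler, sweedler_tmul,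
    h.comul_act_left, sweedler_sweedler, sweedler_of_tmul, comul_one_eq_tmul, hn.one_laws,
    hs.one_laws, one_mul, mul_one, mul_smul_comm, map_smul, LinearMap.smul_apply,
    sweedler_counit_left, sweedler_counit_right]
  simp only [tmul_sweedler]
  simp only [sweedler_comm (M := A) (N := A) (Q := H) (R := H),
    sweedler_comm (M := H) (N := A) (Q := H) (R := H)]
  simp (disch := fun_prop) only [sweedler_coassoc, hs.coact_left.sweedler_coassoc]
  simp only [sweedler_comm (M := H) (N := H) (Q := A) (R := A),
    sweedler_comm (M := H) (N := H) (Q := H) (R := A)]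
  refine sweedler_congr fun a₁ c => sweedler_congr fun k d => ?_
  rw [sweedler_comm]
  refine sweedler_congr fun x₁ u => ?_
  rw [sweedler_comm]
  refine sweedler_congr fun x₂ v => ?_
  refine (sweedler_congr fun _ _ => sweedler_comm _ _ _).trans ?_
  refine (sweedler_coassoc v (by fun_prop) (by fun_prop) (by fun_prop)).symm.trans ?_
  rw [sweedler_comm]
  refine Eq.trans ?_ (sweedler_congr fun _ _ => sweedler_comm _ _ _)
  refine Eq.trans ?_ (sweedler_coassoc v (by fun_prop) (by fun_prop) (by fun_prop))
  refine sweedler_congr fun w y => ?_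
  exact h.sweedler_yetterDrinfeld_left w d (f := fun p q =>
    τ (lact x₁ a₁ * σ x₂ k) p 1 ⊗ₜ[K] τ q y 1) (by fun_prop) (by fun_prop)

/-- (E2) expands `Δ(b ◁ x)` and (D17) moves the coaction past the action. The remaining cocycle in
the second factor disappears by the case `b' = 1` of (E3). -/
theorem comulMul_right_mid (he : IsRealization lact σ ρ ract ψ τ)
    (hs : IsSetting lact σ ρ ract ψ) (h : BiproductConditions lact σ ρ ract ψ)
    (b : B) (x : H) : ComulMul K (τ 1 1 b) (τ 1 x 1) := by
  have hn := h.isNormalized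
  simp only [ComulMul, he.comul_mid hn, he.comul_right hn, sweedler_mul]
  simp only [mul_sweedler, Algebra.TensorProduct.tmul_mul_tmul]
  simp (disch := fun_prop) only [he.mul, he.comul_apply, map_sweedler, sweedler_tmul,
    h.comul_act_right, sweedler_sweedler, sweedler_of_tmul, comul_one_eq_tmul, hn.one_laws,
    hs.one_laws, Bialgebra.counit_one, one_mul, mul_one, one_smul, mul_smul_comm, smul_mul_assoc,
    map_smul, LinearMap.smul_apply, sweedler_smul, sweedler_counit_left]
  simp only [tmul_sweedler]
  simp only [sweedler_comm (M := B) (N := B) (Q := H) (R := H),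
    sweedler_comm (M := B) (N := H) (Q := H) (R := H)]
  simp (disch := fun_prop) only [sweedler_coassoc, hs.coact_right.sweedler_coassoc]
  simp (disch := fun_prop) only [sweedler_comm (M := B) (N := B) (Q := H) (R := H),
    sweedler_comm (M := B) (N := H) (Q := H) (R := H)]
  simp only [sweedler_comm (M := H) (N := H) (Q := B) (R := B)]
  refine sweedler_congr fun b₁ b₂ => sweedler_congr fun x₁ u => ?_
  refine (sweedler_coassoc u (by fun_prop) (by fun_prop) (by fun_prop)).symm.trans ?_
  refine Eq.trans ?_ (sweedler_coassoc u (by fun_prop) (by fun_prop) (by fun_prop))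
  have key := fun w y => h.sweedler_yetterDrinfeld_right b₁ w (f := fun p q =>
    τ 1 x₁ p ⊗ₜ[K] τ 1 q (ract b₂ y)) (by fun_prop) (by fun_prop)
  simp only [key]
  refine (sweedler_coassoc u (by fun_prop) (by fun_prop) (by fun_prop)).trans ?_
  refine sweedler_congr fun w v => ?_
  refine Eq.trans ?_ (sweedler_comm _ _ _)
  refine sweedler_congr fun y z => ?_
  refine Eq.trans ?_ (sweedler_comm _ _ _)
  refine sweedler_congr fun c k => ?_
  exact h.sweedler_cocycle_act hs w c (f := fun p q =>
    τ 1 x₁ p ⊗ₜ[K] τ q (k * y) (ract b₂ z)) (by fun_prop) (by fun_prop)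

/-- In the product of the coproducts, `b₁` acts on `a₂₀` while `a₂₋₁` acts on `b₁`. (D21) says that
this exchange is trivial. -/
theorem comulMul_right_left (he : IsRealization lact σ ρ ract ψ τ)
    (hs : IsSetting lact σ ρ ract ψ) (h : BiproductConditions lact σ ρ ract ψ)
    (b : B) (a : A) : ComulMul K (τ 1 1 b) (τ a 1 1) := by
  have hn := h.isNormalized
  simp only [ComulMul, he.comul_left hn, he.comul_right hn, sweedler_mul]
  simp only [mul_sweedler, Algebra.TensorProduct.tmul_mul_tmul]
  simp (disch := fun_prop) only [he.mul, he.comul_apply, sweedler_tmul, sweedler_of_tmul,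
    comul_one_eq_tmul, hs.one_laws, one_mul, mul_one, mul_smul_comm, map_smul, LinearMap.smul_apply,
    sweedler_smul, sweedler_counit_left]
  simp only [tmul_sweedler]
  simp (disch := fun_prop) only [hs.coact_left.sweedler_coassoc,
    sweedler_comm (M := A) (N := A) (Q := H) (R := H),
    sweedler_comm (M := H) (N := A) (Q := H) (R := H)]
  simp (disch := fun_prop) only [hs.coact_right.sweedler_coassoc,
    sweedler_comm (M := A) (N := A) (Q := B) (R := B),
    sweedler_comm (M := H) (N := A) (Q := B) (R := B),
    sweedler_comm (M := A) (N := A) (Q := B) (R := H),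
    sweedler_comm (M := H) (N := A) (Q := B) (R := H)]
  refine sweedler_congr fun b₁ b₂ => sweedler_congr fun c k => ?_
  rw [sweedler_comm]
  refine sweedler_congr fun a₁ a₂ => ?_
  rw [sweedler_comm]
  refine sweedler_congr fun y d => ?_
  rw [sweedler_comm]
  exact (h.sweedler_double_biproduct d c (f := fun p q =>
    τ a₁ y q ⊗ₜ[K] τ p k b₂) (by fun_prop) (by fun_prop)).symm

end Multiplicativity

/-! ### From generators to all products; the counit. -/

section Closure

variable {K : Type*} [Field K] {W : Type*} [Ring W] [Algebra K W] [Coalgebra K W]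

namespace ComulMul

theorem add_left {u v w : W} (hu : ComulMul K u w) (hv : ComulMul K v w) :
    ComulMul K (u + v) w := by
  unfold ComulMul at *
  rw [add_mul, map_add, map_add, add_mul, hu, hv]

theorem add_right {u v w : W} (hv : ComulMul K u v) (hw : ComulMul K u w) :
    ComulMul K u (v + w) := by
  unfold ComulMul at *
  rw [mul_add, map_add, map_add, mul_add, hv, hw]

theorem sweedler_left {M N : Type*} [AddCommGroup M] [Module K M] [AddCommGroup N] [Module K N]
    {t : M ⊗[K] N} {f : M → N → W} {w : W} (h : ∀ m n, ComulMul K (f m n) w) :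
    ComulMul K (sweedler K t f) w := by
  unfold ComulMul at *
  simp only [sweedler_mul, map_sweedler, h]

/-- Associativity in `W` and in `W ⊗ W`: both `Δ(u(vw))` and `Δ(u)Δ(vw)` are compared with
`Δ(u)Δ(v)Δ(w)`. -/
theorem mul_right {u v w : W} (huv : ComulMul K u v) (hvw : ComulMul K v w)
    (huvw : ComulMul K (u * v) w) : ComulMul K u (v * w) := by
  unfold ComulMul at *
  rw [← mul_assoc, huvw, huv, hvw, mul_assoc]

theorem mul_left {u v w : W} (huv : ComulMul K u v) (hvw : ComulMul K v w)
    (huvw : ComulMul K u (v * w)) : ComulMul K (u * v) w := by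
  unfold ComulMul at *
  rw [mul_assoc, huvw, huv, hvw, mul_assoc]

end ComulMul

variable {H : Type*} [Ring H] [Bialgebra K H]
  {A : Type*} [Ring A] [Algebra K A] [Coalgebra K A]
  {B : Type*} [Ring B] [Algebra K B] [Coalgebra K B]
  {lact : H →ₗ[K] A →ₗ[K] A} {σ : H →ₗ[K] H →ₗ[K] A}
  {ρ : A →ₗ[K] H ⊗[K] A} {ract : B →ₗ[K] H →ₗ[K] B} {ψ : B →ₗ[K] B ⊗[K] H}
  {τ : A →ₗ[K] H →ₗ[K] B →ₗ[K] W}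

namespace IsRealization

theorem left_mul (he : IsRealization lact σ ρ ract ψ τ) (hs : IsSetting lact σ ρ ract ψ)
    (a a' : A) (x : H) (b : B) : τ a 1 1 * τ a' x b = τ (a * a') x b := by
  simp (disch := fun_prop) only [he.mul, sweedler_of_tmul, Bialgebra.comul_one,
    Algebra.TensorProduct.one_def, hs.act_right.one_act, hs.act_left.one_act, hs.cocycle.left_one,
    one_mul, mul_smul_comm, smul_mul_assoc, mul_one, map_smul, LinearMap.smul_apply,
    sweedler_counit_right, sweedler_counit_left]

theorem mul_right (he : IsRealization lact σ ρ ract ψ τ) (hs : IsSetting lact σ ρ ract ψ)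
    (a : A) (x : H) (b b' : B) : τ a x b * τ 1 1 b' = τ a x (b * b') := by
  simp (disch := fun_prop) only [he.mul, sweedler_of_tmul, Bialgebra.comul_one,
    Algebra.TensorProduct.one_def, hs.act_right.act_one, hs.act_left.act_one, hs.cocycle.right_one,
    mul_smul_comm, smul_mul_assoc, mul_one, map_smul, LinearMap.smul_apply, sweedler_counit_left,
    sweedler_smul]

theorem right_mul_left (he : IsRealization lact σ ρ ract ψ τ) (hs : IsSetting lact σ ρ ract ψ)
    (a : A) (b : B) : τ 1 1 b * τ a 1 1 = τ a 1 b := by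
  simp (disch := fun_prop) only [he.mul, sweedler_of_tmul, Bialgebra.comul_one,
    Algebra.TensorProduct.one_def, hs.act_right.act_one, hs.act_left.one_act, hs.cocycle.right_one,
    Bialgebra.counit_one, one_smul, one_mul, mul_one]

theorem mid_mul_left (he : IsRealization lact σ ρ ract ψ τ) (hs : IsSetting lact σ ρ ract ψ)
    (a : A) (x : H) : τ 1 x 1 * τ a 1 1 =
      sweedler K (Coalgebra.comul x) fun x₁ x₂ => τ (lact x₁ a) x₂ 1 := by
  simp (disch := fun_prop) only [he.mul, sweedler_of_tmul, Bialgebra.comul_one,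
    Algebra.TensorProduct.one_def, hs.act_right.act_one, hs.cocycle.right_one, one_mul, mul_one,
    mul_smul_comm, map_smul, LinearMap.smul_apply, sweedler_counit_left]

theorem left_mul_mid_mul_right (he : IsRealization lact σ ρ ract ψ τ)
    (hs : IsSetting lact σ ρ ract ψ) (a : A) (x : H) (b : B) :
    τ a 1 1 * (τ 1 x 1 * τ 1 1 b) = τ a x b := by
  rw [he.mul_right hs, he.left_mul hs, mul_one, one_mul]

/-- Factors from `A` on the left and from `B` on the right are treated first, because multiplying by
them keeps pure tensors pure. -/
theorem comulMul_left (he : IsRealization lact σ ρ ract ψ τ) (hs : IsSetting lact σ ρ ract ψ)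
    (h : BiproductConditions lact σ ρ ract ψ) (a : A) (w : W) : ComulMul K (τ a 1 1) w := by
  refine he.induction (p := fun w => ComulMul K (τ a 1 1) w) (fun a' x b => ?_)
    (fun u v hu hv => hu.add_right hv) w
  have key := (comulMul_left_left he hs h a a').mul_right (comulMul_left_right he hs h a' x b)
    (by rw [he.left_mul hs]; exact comulMul_left_right he hs h _ x b)
  rwa [he.left_mul hs, mul_one] at key

theorem comulMul_right (he : IsRealization lact σ ρ ract ψ τ) (hs : IsSetting lact σ ρ ract ψ)
    (h : BiproductConditions lact σ ρ ract ψ) (w : W) (b : B) : ComulMul K w (τ 1 1 b) := by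
  refine he.induction (p := fun w => ComulMul K w (τ 1 1 b)) (fun a x b' => ?_)
    (fun u v hu hv => hu.add_left hv) w
  rw [← he.left_mul_mid_mul_right hs]
  refine ComulMul.mul_left (he.comulMul_left hs h a _) ?_ (he.comulMul_left hs h a _)
  refine ComulMul.mul_left (comulMul_mid_right he hs h x b') (comulMul_right_right he hs h b' b) ?_
  rw [he.mul_right hs]
  exact comulMul_mid_right he hs h x _

/-- Split `w` as `a · x · b`: the trailing `b` is always harmless, so a general left factor `u` need
only be tested against `a`, and `u · a` against `x`. -/
theorem comulMul_of_left_mid (he : IsRealization lact σ ρ ract ψ τ)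
    (hs : IsSetting lact σ ρ ract ψ) (h : BiproductConditions lact σ ρ ract ψ) {u : W}
    (hl : ∀ a, ComulMul K u (τ a 1 1)) (hm : ∀ a x, ComulMul K (u * τ a 1 1) (τ 1 x 1)) (w : W) :
    ComulMul K u w := by
  refine he.induction (p := fun w => ComulMul K u w) (fun a x b => ?_)
    (fun u v hu hv => hu.add_right hv) w
  rw [← he.left_mul_mid_mul_right hs, ← mul_assoc]
  exact ((hl a).mul_right (he.comulMul_left hs h a _) (hm a x)).mul_right
    (he.comulMul_right hs h _ b) (he.comulMul_right hs h _ b)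

theorem comulMul_mid (he : IsRealization lact σ ρ ract ψ τ) (hs : IsSetting lact σ ρ ract ψ)
    (h : BiproductConditions lact σ ρ ract ψ) (x : H) (w : W) : ComulMul K (τ 1 x 1) w := by
  refine he.comulMul_of_left_mid hs h (fun a => comulMul_mid_left he hs h x a) (fun a x' => ?_) w
  -- Moving `a` to the front of `x · a` leaves terms `(x₁ ▷ a) · x₂`, so only the pair `x₂`, `x'` in
  -- `H` matters.
  rw [he.mid_mul_left hs]
  refine ComulMul.sweedler_left fun x₁ x₂ => ?_
  have key := (he.comulMul_left hs h (lact x₁ a) (τ 1 x₂ 1)).mul_left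
    (comulMul_mid_mid he hs h x₂ x') (he.comulMul_left hs h _ _)
  rwa [he.left_mul hs, mul_one] at key

theorem comulMul_right_left (he : IsRealization lact σ ρ ract ψ τ)
    (hs : IsSetting lact σ ρ ract ψ) (h : BiproductConditions lact σ ρ ract ψ) (b : B) (w : W) :
    ComulMul K (τ 1 1 b) w := by
  refine he.comulMul_of_left_mid hs h (fun a => CrossedBiproduct.comulMul_right_left he hs h b a)
    (fun a x => ?_) w
  rw [he.right_mul_left hs, ← he.left_mul_mid_mul_right hs, he.mul_right hs, one_mul]
  exact (he.comulMul_left hs h a _).mul_left (comulMul_right_mid he hs h b x)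
    (he.comulMul_left hs h _ _)

/-- The compatibility conditions make the comultiplication multiplicative. -/
theorem comul_mul (he : IsRealization lact σ ρ ract ψ τ) (hs : IsSetting lact σ ρ ract ψ)
    (h : BiproductConditions lact σ ρ ract ψ) (u v : W) : ComulMul K u v := by
  refine he.induction (p := fun u => ComulMul K u v) (fun a x b => ?_)
    (fun u v hu hv => hu.add_left hv) u
  rw [← he.left_mul_mid_mul_right hs]
  exact (he.comulMul_left hs h a _).mul_left ((he.comulMul_mid hs h x _).mul_left
    (he.comulMul_right_left hs h b v) (he.comulMul_mid hs h x _)) (he.comulMul_left hs h a _)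

theorem comul_one (he : IsRealization lact σ ρ ract ψ τ)
    (h : BiproductConditions lact σ ρ ract ψ) : Coalgebra.comul (R := K) (1 : W) = 1 := by
  rw [← he.one, he.comul_apply]
  simp (disch := fun_prop) only [sweedler_of_tmul, Bialgebra.comul_one, mul_one, h.comul_one_left,
    h.comul_one_right, h.coact_one_left, h.coact_one_right, Algebra.TensorProduct.one_def, he.one]

theorem counit_one (he : IsRealization lact σ ρ ract ψ τ)
    (h : BiproductConditions lact σ ρ ract ψ) : Coalgebra.counit (R := K) (1 : W) = 1 := by
  rw [← he.one, he.counit_apply, h.counit_alg_left.1, h.counit_alg_right.1, Bialgebra.counit_one,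
    mul_one, mul_one]

theorem counit_mul (he : IsRealization lact σ ρ ract ψ τ) (hs : IsSetting lact σ ρ ract ψ)
    (h : BiproductConditions lact σ ρ ract ψ) (u v : W) : Coalgebra.counit (R := K) (u * v) =
      Coalgebra.counit (R := K) u * Coalgebra.counit (R := K) v := by
  refine he.induction (p := fun u => Coalgebra.counit (R := K) (u * v) =
    Coalgebra.counit (R := K) u * Coalgebra.counit (R := K) v) (fun a x b => ?_)
    (fun u v hu hv => by rw [add_mul, map_add, map_add, add_mul, hu, hv]) u
  refine he.induction (p := fun v => Coalgebra.counit (R := K) (τ a x b * v) =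
    Coalgebra.counit (R := K) (τ a x b) * Coalgebra.counit (R := K) v) (fun a' x' b' => ?_)
    (fun u v hu hv => by rw [mul_add, map_add, map_add, mul_add, hu, hv]) v
  simp (disch := fun_prop) only [he.mul, map_sweedler, he.counit_apply, h.counit_alg_left.2,
    h.counit_alg_right.2, h.counit_act_left, h.counit_act_right, hs.counit_cocycle,
    Bialgebra.counit_mul]
  -- The scalars are ordered by the nesting of the sums, outermost first, so that the counit law
  -- eliminates each sum in turn.
  have key : ∀ c c' d d' x₁ x₂ x₃ y₁ y₂ y₃ : K,
      c * (c' * x₁) * (x₂ * y₁) * (x₃ * y₂) * (d * y₃ * d') =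
        x₁ • x₂ • x₃ • y₁ • y₂ • (y₃ * (c * c' * d * d')) := fun _ _ _ _ _ _ _ _ _ _ => by
    simp only [smul_eq_mul]
    ring
  simp (disch := fun_prop) only [key, sweedler_smul, sweedler_counit_left]
  simp only [smul_eq_mul]
  ring

end IsRealization

end Closure

/-! ### Associativity of the crossed product, from the standing hypotheses. -/

section Multilinear
variable {K : Type*} [Field K] {M N P Q R S : Type*} [AddCommGroup M] [Module K M]
  [AddCommGroup N] [Module K N] [AddCommGroup P] [Module K P] [AddCommGroup Q] [Module K Q]
  [AddCommGroup R] [Module K R] [AddCommGroup S] [Module K S]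

theorem bilinear_sweedler (F : P →ₗ[K] Q →ₗ[K] R) (t : M ⊗[K] N) (f : M → N → P) (q : Q) :
    F (sweedler K t f) q = sweedler K t fun m n => F (f m n) q :=
  map_sweedler (F.flip q) t f

theorem trilinear_sweedler (F : P →ₗ[K] Q →ₗ[K] R →ₗ[K] S) (t : M ⊗[K] N) (f : M → N → P) (q : Q)
    (r : R) : F (sweedler K t f) q r = sweedler K t fun m n => F (f m n) q r := by
  simp only [sweedler, map_sum, LinearMap.sum_apply]

end Multilinear

section Interleaved
variable {K : Type*} [Field K] {P : Type*} [AddCommGroup P] [Module K P]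
  {C : Type*} [AddCommGroup C] [Module K C] [Coalgebra K C]

/-- Needed when the expansion of `v` separates `Δ(u)` from `Δ(x)`: all sums here have the same type,
so the typed interchange rules cannot bring them together. -/
theorem sweedler_coassoc_interleaved (x : C) {f : C → C → C → C → P}
    (h₁ : ∀ q r s, IsLinearMap K fun p => f p q r s)
    (h₂ : ∀ p r s, IsLinearMap K fun q => f p q r s)
    (h₃ : ∀ p q s, IsLinearMap K fun r => f p q r s)
    (h₄ : ∀ p q r, IsLinearMap K fun s => f p q r s) :
    (sweedler K (comul x) fun u v => sweedler K (comul v) fun r s => sweedler K (comul u) fun p q =>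
      f p q r s) =
    sweedler K (comul x) fun p u => sweedler K (comul u) fun q v => sweedler K (comul v) fun r s =>
      f p q r s := by
  refine Eq.trans (sweedler_congr fun u v => sweedler_comm _ _ _) ?_
  exact sweedler_coassoc x (f := fun p q v => sweedler K (comul v) fun r s => f p q r s)
    (by fun_prop) (by fun_prop) (by fun_prop)

end Interleaved

section Formulas

variable {K : Type*} [Field K] {H : Type*} [Ring H] [Bialgebra K H]
  {V : Type*} [AddCommGroup V] [Module K V]

/-- The bilinear map `μ` is given by the product of `A #^σ H # B`. -/
abbrev IsCrossedMul {A : Type*} [Ring A] [Algebra K A] {B : Type*} [Ring B] [Algebra K B]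
    (lact : H →ₗ[K] A →ₗ[K] A) (σ : H →ₗ[K] H →ₗ[K] A) (ract : B →ₗ[K] H →ₗ[K] B)
    (τ : A →ₗ[K] H →ₗ[K] B →ₗ[K] V) (μ : V →ₗ[K] V →ₗ[K] V) : Prop :=
  ∀ (a a' : A) (x x' : H) (b b' : B), μ (τ a x b) (τ a' x' b') =
    sweedler K (comul x) fun x₁ y => sweedler K (comul y) fun x₂ x₃ =>
      sweedler K (comul x') fun x'₁ y' => sweedler K (comul y') fun x'₂ x'₃ =>
        τ (a * lact x₁ a' * σ x₂ x'₁) (x₃ * x'₂) (ract b x'₃ * b')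

/-- The linear map `δ` is given by the coproduct of `A × H × B`. -/
abbrev IsSmashComul {A : Type*} [AddCommGroup A] [Module K A] [Coalgebra K A]
    {B : Type*} [AddCommGroup B] [Module K B] [Coalgebra K B]
    (ρ : A →ₗ[K] H ⊗[K] A) (ψ : B →ₗ[K] B ⊗[K] H)
    (τ : A →ₗ[K] H →ₗ[K] B →ₗ[K] V) (δ : V →ₗ[K] V ⊗[K] V) : Prop :=
  ∀ (a : A) (x : H) (b : B), δ (τ a x b) =
    sweedler K (comul a) fun a₁ a₂ => sweedler K (ρ a₂) fun h a₂₀ =>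
      sweedler K (comul x) fun x₁ x₂ =>
        sweedler K (comul b) fun b₁ b₂ => sweedler K (ψ b₁) fun b₁₀ k =>
          τ a₁ (h * x₁) b₁₀ ⊗ₜ[K] τ a₂₀ (x₂ * k) b₂

end Formulas

section Associativity

variable {K : Type*} [Field K] {H : Type*} [Ring H] [Bialgebra K H]
  {A : Type*} [Ring A] [Algebra K A] {B : Type*} [Ring B] [Algebra K B]
  {lact : H →ₗ[K] A →ₗ[K] A} {σ : H →ₗ[K] H →ₗ[K] A} {ract : B →ₗ[K] H →ₗ[K] B}
  {C D E : Type*} [AddCommGroup C] [Module K C] [Coalgebra K C]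
  [AddCommGroup D] [Module K D] [Coalgebra K D] [AddCommGroup E] [Module K E] [Coalgebra K E]
  {i : C →ₗ[K] H} {j : D →ₗ[K] H} {k : E →ₗ[K] H}
  {P : Type*} [AddCommGroup P] [Module K P]

/-- The cocycle identity, evaluated under a linear map, with spare coproduct factors. -/
theorem IsCrossedCocycle.sweedler_cocycle (hσ : IsCrossedCocycle lact σ)
    (hi : ∀ x, comul (R := K) (i x) = sweedler K (comul x) fun u v => i u ⊗ₜ[K] i v)
    (hj : ∀ x, comul (R := K) (j x) = sweedler K (comul x) fun u v => j u ⊗ₜ[K] j v)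
    (hk : ∀ x, comul (R := K) (k x) = sweedler K (comul x) fun u v => k u ⊗ₜ[K] k v)
    (x : C) (y : D) (z : E) {f : A → C → D → E → P}
    (h₁ : ∀ u v w, IsLinearMap K fun c => f c u v w)
    (h₂ : ∀ c v w, IsLinearMap K fun u => f c u v w)
    (h₃ : ∀ c u w, IsLinearMap K fun v => f c u v w)
    (h₄ : ∀ c u v, IsLinearMap K fun w => f c u v w) :
    (sweedler K (comul x) fun x₁ u => sweedler K (comul u) fun x₂ x₃ =>
      sweedler K (comul y) fun y₁ v => sweedler K (comul v) fun y₂ y₃ =>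
        sweedler K (comul z) fun z₁ w => sweedler K (comul w) fun z₂ z₃ =>
          f (lact (i x₁) (σ (j y₁) (k z₁)) * σ (i x₂) (j y₂ * k z₂)) x₃ y₃ z₃) =
    sweedler K (comul x) fun x₁ u => sweedler K (comul u) fun x₂ x₃ =>
      sweedler K (comul y) fun y₁ v => sweedler K (comul v) fun y₂ y₃ =>
        sweedler K (comul z) fun z₁ z₂ =>
          f (σ (i x₁) (j y₁) * σ (i x₂ * j y₂) (k z₁)) x₃ y₃ z₂ := by
  have key := sweedler_congr (t := comul (R := K) x) fun u x₃ =>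
    sweedler_congr (t := comul (R := K) y) fun v y₃ =>
      sweedler_congr (t := comul (R := K) z) fun w z₃ =>
        congrArg (IsLinearMap.mk' _ (h₁ x₃ y₃ z₃)) (hσ.cocycle (i u) (j v) (k w))
  simp (disch := fun_prop) only [map_sweedler, IsLinearMap.mk'_apply, hi, hj, hk, sweedler_sweedler,
    sweedler_of_tmul] at key
  simpa (disch := fun_prop) only [sweedler_comm (M := D) (N := D) (Q := C) (R := C),
    sweedler_comm (M := E) (N := E) (Q := C) (R := C),
    sweedler_comm (M := E) (N := E) (Q := D) (R := D), sweedler_coassoc] using key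

/-- The twisted module identity, evaluated under a linear map, with spare coproduct factors. -/
theorem IsCrossedCocycle.sweedler_twisted_module (hσ : IsCrossedCocycle lact σ)
    (hi : ∀ x, comul (R := K) (i x) = sweedler K (comul x) fun u v => i u ⊗ₜ[K] i v)
    (hj : ∀ x, comul (R := K) (j x) = sweedler K (comul x) fun u v => j u ⊗ₜ[K] j v)
    (x : C) (y : D) (a : A) {f : A → C → D → P}
    (h₁ : ∀ u v, IsLinearMap K fun c => f c u v)
    (h₂ : ∀ c v, IsLinearMap K fun u => f c u v)
    (h₃ : ∀ c u, IsLinearMap K fun v => f c u v) :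
    (sweedler K (comul x) fun x₁ u => sweedler K (comul u) fun x₂ x₃ =>
      sweedler K (comul y) fun y₁ v => sweedler K (comul v) fun y₂ y₃ =>
        f (lact (i x₁) (lact (j y₁) a) * σ (i x₂) (j y₂)) x₃ y₃) =
    sweedler K (comul x) fun x₁ u => sweedler K (comul u) fun x₂ x₃ =>
      sweedler K (comul y) fun y₁ v => sweedler K (comul v) fun y₂ y₃ =>
        f (σ (i x₁) (j y₁) * lact (i x₂ * j y₂) a) x₃ y₃ := by
  have key := sweedler_congr (t := comul (R := K) x) fun u x₃ =>
    sweedler_congr (t := comul (R := K) y) fun v y₃ =>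
      congrArg (IsLinearMap.mk' _ (h₁ x₃ y₃)) (hσ.twisted_module (i u) (j v) a)
  simp (disch := fun_prop) only [map_sweedler, IsLinearMap.mk'_apply, hi, hj, sweedler_sweedler,
    sweedler_of_tmul] at key
  simpa (disch := fun_prop) only [sweedler_comm (M := D) (N := D) (Q := C) (R := C),
    sweedler_coassoc] using key

variable {V : Type*} [AddCommGroup V] [Module K V]
  {τ : A →ₗ[K] H →ₗ[K] B →ₗ[K] V} {μ : V →ₗ[K] V →ₗ[K] V}

-- The spaces `C`, `D`, `E` are labelled stand-ins for three copies of `H`, mapped to it compatibly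
-- with the coproducts (later by the identity). Distinct types record whether a sum comes from `x`,
-- `y` or `z`, so typed interchange can sort them.
set_option maxHeartbeats 1000000 in
theorem crossed_mul_assoc (hlact : IsLeftWeakAction lact) (hσ : IsCrossedCocycle lact σ)
    (hract : IsRightModuleAlgebra ract)
    (hμ : IsCrossedMul lact σ ract τ μ)
    (hi : ∀ x, comul (R := K) (i x) = sweedler K (comul x) fun u v => i u ⊗ₜ[K] i v)
    (hj : ∀ x, comul (R := K) (j x) = sweedler K (comul x) fun u v => j u ⊗ₜ[K] j v)
    (hk : ∀ x, comul (R := K) (k x) = sweedler K (comul x) fun u v => k u ⊗ₜ[K] k v)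
    (a a' a'' : A) (x : C) (y : D) (z : E) (b b' b'' : B) :
    μ (μ (τ a (i x) b) (τ a' (j y) b')) (τ a'' (k z) b'') =
      μ (τ a (i x) b) (μ (τ a' (j y) b') (τ a'' (k z) b'')) := by
  simp (disch := fun_prop) only [hμ, map_sweedler (Q := V), bilinear_sweedler (P := V),
    trilinear_sweedler, sweedler_comul_mul, hract.mul_act, hlact.act_mul, sweedler_mul,
    mul_sweedler, hract.act_mul, hi, hj, hk, sweedler_sweedler, sweedler_of_tmul]
  simp (disch := fun_prop) only [sweedler_comm (M := D) (N := D) (Q := C) (R := C),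
    sweedler_comm (M := E) (N := E) (Q := C) (R := C),
    sweedler_comm (M := E) (N := E) (Q := D) (R := D), sweedler_coassoc,
    sweedler_coassoc_interleaved, mul_assoc]
  -- The right-bracketed product contains `(x₂ ▷ (y₁ ▷ a'')) (x₃ ▷ σ(y₂, z₁)) σ(x₄, y₃ z₂)`; the
  -- cocycle law turns its last two factors into `σ(x₃, y₂) σ(x₄ y₃, z₁)`.
  have S₂ := sweedler_congr (t := comul (R := K) x) fun c₁ u =>
    sweedler_congr (t := comul (R := K) u) fun c₂ u =>
    sweedler_congr (t := comul (R := K) y) fun d₁ v =>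
      hσ.sweedler_cocycle hi hj hk u v z (f := fun s c₅ v w => sweedler K (comul v) fun d₄ d₅ =>
        sweedler K (comul w) fun e₃ w => sweedler K (comul w) fun e₄ e₅ =>
          τ (a * (lact (i c₁) a' * (lact (i c₂) (lact (j d₁) a'') * s))) (i c₅ * (j d₄ * k e₃))
            (ract (ract b (j d₅)) (k e₄) * (ract b' (k e₅) * b'')))
        (by fun_prop) (by fun_prop) (by fun_prop) (by fun_prop)
  -- The twisted module law then turns `(x₂ ▷ (y₁ ▷ a'')) σ(x₃, y₂)` into `σ(x₂, y₁) (x₃ y₂ ▷ a'')`,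
  -- as in the left-bracketed product.
  have S₁ := sweedler_congr (t := comul (R := K) x) fun c₁ u =>
      hσ.sweedler_twisted_module hi hj u y a'' (f := fun s u v => sweedler K (comul u) fun c₄ c₅ =>
        sweedler K (comul v) fun d₃ v => sweedler K (comul v) fun d₄ d₅ =>
        sweedler K (comul z) fun e₁ w => sweedler K (comul w) fun e₂ w =>
          sweedler K (comul w) fun e₃ e₄ =>
          τ (a * (lact (i c₁) a' * (s * σ (i c₄ * j d₃) (k e₁)))) (i c₅ * (j d₄ * k e₂))
            (ract (ract b (j d₅)) (k e₃) * (ract b' (k e₄) * b'')))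
        (by fun_prop) (by fun_prop) (by fun_prop)
  simp (disch := fun_prop) only [sweedler_comm (M := D) (N := D) (Q := C) (R := C),
    sweedler_comm (M := E) (N := E) (Q := D) (R := D), mul_assoc] at S₁ S₂
  exact (S₂.trans S₁).symm

end Associativity

/-! ### Coassociativity of the smash coproduct. -/

section Coassociativity

variable {K : Type*} [Field K] {H : Type*} [Ring H] [Bialgebra K H] {P : Type*} [AddCommGroup P]
  [Module K P]

/-- The `A`-part of coassociativity. Compatibility of the coaction with `Δ_A` expands the right
side; coassociativity of `Δ_A` and of the coaction finish. -/
theorem IsLeftComoduleCoalgebra.sweedler_smash_coassoc {A : Type*} [AddCommGroup A] [Module K A]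
    [Coalgebra K A] {ρ : A →ₗ[K] H ⊗[K] A} (hρ : IsLeftComoduleCoalgebra ρ) (a : A)
    {f : A → H → A → H → A → P} (h₁ : ∀ q r s t, IsLinearMap K fun p => f p q r s t)
    (h₂ : ∀ p r s t, IsLinearMap K fun q => f p q r s t)
    (h₃ : ∀ p q s t, IsLinearMap K fun r => f p q r s t)
    (h₄ : ∀ p q r t, IsLinearMap K fun s => f p q r s t)
    (h₅ : ∀ p q r s, IsLinearMap K fun t => f p q r s t) :
    (sweedler K (comul a) fun a₁ a₂ => sweedler K (ρ a₂) fun h c => sweedler K (comul a₁) fun p q =>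
      sweedler K (ρ q) fun h' q₀ => sweedler K (comul h) fun x y => f p (h' * x) q₀ y c) =
    sweedler K (comul a) fun a₁ a₂ => sweedler K (ρ a₂) fun h c => sweedler K (comul c) fun p q =>
      sweedler K (ρ q) fun h' q₀ => f a₁ h p h' q₀ := by
  simp (disch := fun_prop) only [hρ.sweedler_comul]
  refine Eq.trans ?_ (CrossedBiproduct.sweedler_coassoc a (f := fun p q r => sweedler K (ρ q)
    fun h q₀ => sweedler K (ρ r) fun k c => sweedler K (ρ c) fun h' c₀ => f p (h * k) q₀ h' c₀)
    (by fun_prop) (by fun_prop) (by fun_prop))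
  refine sweedler_congr fun u v => Eq.trans (sweedler_comm _ _ _) (sweedler_congr fun p q => ?_)
  refine Eq.trans (sweedler_comm _ _ _) (sweedler_congr fun h' q₀ => ?_)
  exact hρ.sweedler_coassoc v (by fun_prop) (by fun_prop) (by fun_prop)

/-- The mirror image for `B`; here compatibility with `Δ_B` expands the left side. -/
theorem IsRightComoduleCoalgebra.sweedler_smash_coassoc {B : Type*} [AddCommGroup B] [Module K B]
    [Coalgebra K B] {ψ : B →ₗ[K] B ⊗[K] H} (hψ : IsRightComoduleCoalgebra ψ) (b : B)
    {f : B → H → B → H → B → P} (h₁ : ∀ q r s t, IsLinearMap K fun p => f p q r s t)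
    (h₂ : ∀ p r s t, IsLinearMap K fun q => f p q r s t)
    (h₃ : ∀ p q s t, IsLinearMap K fun r => f p q r s t)
    (h₄ : ∀ p q r t, IsLinearMap K fun s => f p q r s t)
    (h₅ : ∀ p q r s, IsLinearMap K fun t => f p q r s t) :
    (sweedler K (comul b) fun b₁ b₂ => sweedler K (ψ b₁) fun c k => sweedler K (comul c) fun p q =>
      sweedler K (ψ p) fun p₀ k' => f p₀ k' q k b₂) =
    sweedler K (comul b) fun b₁ b₂ => sweedler K (ψ b₁) fun c k => sweedler K (comul k) fun x y =>
      sweedler K (comul b₂) fun p q => sweedler K (ψ p) fun p₀ k' => f c x p₀ (y * k') q := by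
  simp (disch := fun_prop) only [hψ.sweedler_comul]
  refine Eq.trans (CrossedBiproduct.sweedler_coassoc b (f := fun u v w => sweedler K (ψ u)
    fun c h => sweedler K (ψ v) fun d k => sweedler K (ψ c) fun p₀ k' => f p₀ k' d (h * k) w)
    (by fun_prop) (by fun_prop) (by fun_prop)) (sweedler_congr fun u v => ?_)
  symm
  refine Eq.trans (hψ.sweedler_coassoc u (f := fun c x y => sweedler K (comul v) fun p q =>
    sweedler K (ψ p) fun p₀ k' => f c x p₀ (y * k') q) (by fun_prop) (by fun_prop)
    (by fun_prop)) ?_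
  refine Eq.trans (sweedler_congr fun c k => sweedler_comm _ _ _) ?_
  refine Eq.trans (sweedler_comm _ _ _) (sweedler_congr fun p q => sweedler_congr fun c k => ?_)
  exact sweedler_comm _ _ _

variable {A : Type*} [AddCommGroup A] [Module K A] [Coalgebra K A] {ρ : A →ₗ[K] H ⊗[K] A}
  {B : Type*} [AddCommGroup B] [Module K B] [Coalgebra K B] {ψ : B →ₗ[K] B ⊗[K] H}
  {C : Type*} [AddCommGroup C] [Module K C] [Coalgebra K C] {i : C →ₗ[K] H}
  {V : Type*} [AddCommGroup V] [Module K V]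
  {τ : A →ₗ[K] H →ₗ[K] B →ₗ[K] V} {δ : V →ₗ[K] V ⊗[K] V}

-- The `A`, `H` and `B` parts separate and are coassociative one at a time. The space `C` stands in
-- for `H` as the middle factor, so that its sums are not confused with the coaction legs in `H`.
set_option maxHeartbeats 1000000 in
theorem smash_comul_coassoc (hρ : IsLeftComoduleCoalgebra ρ) (hψ : IsRightComoduleCoalgebra ψ)
    (hδ : IsSmashComul ρ ψ τ δ)
    (hi : ∀ x, comul (R := K) (i x) = sweedler K (comul x) fun u v => i u ⊗ₜ[K] i v)
    (a : A) (x : C) (b : B) :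
    TensorProduct.assoc K V V V (δ.rTensor V (δ (τ a (i x) b))) =
      δ.lTensor V (δ (τ a (i x) b)) := by
  have S₁ := hρ.sweedler_smash_coassoc a (f := fun p s q t r => sweedler K (comul x) fun x₁ x₂ =>
    sweedler K (comul x₁) fun x₁₁ x₁₂ => sweedler K (comul b) fun b₁ b₂ =>
      sweedler K (ψ b₁) fun c k => sweedler K (comul c) fun d e =>
        sweedler K (ψ d) fun d₀ k' =>
    τ p (s * i x₁₁) d₀ ⊗ₜ[K] (τ q (t * (i x₁₂ * k')) e ⊗ₜ[K] τ r (i x₂ * k) b₂))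
    (by fun_prop) (by fun_prop) (by fun_prop) (by fun_prop) (by fun_prop)
  have S₂ := sweedler_congr (t := comul (R := K) a) fun p u => sweedler_congr (t := ρ u) fun s c =>
    sweedler_congr (t := comul (R := K) c) fun q v => sweedler_congr (t := ρ v) fun t r =>
    sweedler_congr (t := comul (R := K) x) fun x₁ x₂ =>
    sweedler_congr (t := comul (R := K) x₂) fun x₂ x₃ =>
    hψ.sweedler_smash_coassoc b (f := fun d m e n g =>
    τ p (s * i x₁) d ⊗ₜ[K] (τ q (t * (i x₂ * m)) e ⊗ₜ[K] τ r (i x₃ * n) g))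
    (by fun_prop) (by fun_prop) (by fun_prop) (by fun_prop) (by fun_prop)
  simp (disch := fun_prop) only [hδ, map_sweedler, equiv_sweedler, LinearMap.rTensor_tmul,
    LinearMap.lTensor_tmul, sweedler_tmul, tmul_sweedler, TensorProduct.assoc_tmul,
    sweedler_comul_mul, hi, sweedler_sweedler, sweedler_of_tmul]
  simp (disch := fun_prop) only [sweedler_coassoc, mul_assoc] at S₁ S₂
  refine Eq.trans ?_ ((S₁.trans S₂).trans ?_)
  · simp (disch := fun_prop) only [sweedler_comm (M := C) (N := C) (Q := A) (R := A),
      sweedler_comm (M := C) (N := C) (Q := H) (R := A),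
      sweedler_comm (M := B) (N := B) (Q := A) (R := A),
      sweedler_comm (M := B) (N := B) (Q := H) (R := A),
      sweedler_comm (M := B) (N := B) (Q := C) (R := C),
      sweedler_comm (M := B) (N := H) (Q := A) (R := A),
      sweedler_comm (M := B) (N := H) (Q := H) (R := A),
      sweedler_comm (M := B) (N := H) (Q := C) (R := C),
      sweedler_comm (M := C) (N := C) (Q := H) (R := H),
      sweedler_comm (M := B) (N := B) (Q := H) (R := H),
      sweedler_comm (M := B) (N := H) (Q := H) (R := H), sweedler_coassoc, mul_assoc]
  · simp (disch := fun_prop) only [sweedler_comm (M := C) (N := C) (Q := A) (R := A),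
      sweedler_comm (M := C) (N := C) (Q := H) (R := A),
      sweedler_comm (M := B) (N := B) (Q := A) (R := A),
      sweedler_comm (M := B) (N := B) (Q := H) (R := A),
      sweedler_comm (M := B) (N := B) (Q := C) (R := C),
      sweedler_comm (M := B) (N := H) (Q := A) (R := A),
      sweedler_comm (M := B) (N := H) (Q := H) (R := A),
      sweedler_comm (M := B) (N := H) (Q := C) (R := C),
      mul_assoc]

end Coassociativity

/-! ### Unit and counit laws. -/

section Units

variable {K : Type*} [Field K] {H : Type*} [Ring H] [Bialgebra K H]
  {V : Type*} [AddCommGroup V] [Module K V]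

theorem crossed_one_mul {A : Type*} [Ring A] [Algebra K A] {B : Type*} [Ring B] [Algebra K B]
    {lact : H →ₗ[K] A →ₗ[K] A} {σ : H →ₗ[K] H →ₗ[K] A} {ract : B →ₗ[K] H →ₗ[K] B}
    {τ : A →ₗ[K] H →ₗ[K] B →ₗ[K] V} {μ : V →ₗ[K] V →ₗ[K] V}
    (hlact : IsLeftWeakAction lact) (hσ : IsCrossedCocycle lact σ)
    (hract : IsRightModuleAlgebra ract)
    (hμ : IsCrossedMul lact σ ract τ μ)
    (a : A) (x : H) (b : B) : μ (τ 1 1 1) (τ a x b) = τ a x b := by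
  simp (disch := fun_prop) only [hμ, Bialgebra.comul_one, Algebra.TensorProduct.one_def,
    sweedler_of_tmul, hlact.one_act, hσ.left_one, hract.one_act, one_mul, mul_one, mul_smul_comm,
    smul_mul_assoc, map_smul, LinearMap.smul_apply, sweedler_counit_left, sweedler_counit_right]

theorem crossed_mul_one {A : Type*} [Ring A] [Algebra K A] {B : Type*} [Ring B] [Algebra K B]
    {lact : H →ₗ[K] A →ₗ[K] A} {σ : H →ₗ[K] H →ₗ[K] A} {ract : B →ₗ[K] H →ₗ[K] B}
    {τ : A →ₗ[K] H →ₗ[K] B →ₗ[K] V} {μ : V →ₗ[K] V →ₗ[K] V}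
    (hlact : IsLeftWeakAction lact) (hσ : IsCrossedCocycle lact σ)
    (hract : IsRightModuleAlgebra ract)
    (hμ : IsCrossedMul lact σ ract τ μ)
    (a : A) (x : H) (b : B) : μ (τ a x b) (τ 1 1 1) = τ a x b := by
  simp (disch := fun_prop) only [hμ, Bialgebra.comul_one, Algebra.TensorProduct.one_def,
    sweedler_of_tmul, hlact.act_one, hσ.right_one, hract.act_one, mul_one, mul_smul_comm,
    smul_mul_assoc, map_smul, LinearMap.smul_apply, sweedler_smul, sweedler_counit_left]

variable {A : Type*} [AddCommGroup A] [Module K A] [Coalgebra K A] {ρ : A →ₗ[K] H ⊗[K] A}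
  {B : Type*} [AddCommGroup B] [Module K B] [Coalgebra K B] {ψ : B →ₗ[K] B ⊗[K] H}
  {τ : A →ₗ[K] H →ₗ[K] B →ₗ[K] V} {δ : V →ₗ[K] V ⊗[K] V} {ε : V →ₗ[K] K}

theorem smash_rTensor_counit (hρ : IsLeftComoduleCoalgebra ρ) (hψ : IsRightComoduleCoalgebra ψ)
    (hδ : IsSmashComul ρ ψ τ δ)
    (hε : ∀ (a : A) (x : H) (b : B), ε (τ a x b) =
      counit (R := K) a * counit (R := K) x * counit (R := K) b)
    (a : A) (x : H) (b : B) : ε.rTensor V (δ (τ a x b)) = 1 ⊗ₜ[K] τ a x b := by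
  have key : ∀ (c₁ c₂ c₃ c₄ : K) (v : V), (c₁ * (c₂ * c₃) * c₄) ⊗ₜ[K] v =
      c₁ • c₂ • c₃ • c₄ • ((1 : K) ⊗ₜ[K] v) := fun c₁ c₂ c₃ c₄ v => by
    simp only [TensorProduct.smul_tmul', smul_eq_mul, mul_one, mul_assoc]
  simp (disch := fun_prop) only [hδ, map_sweedler, LinearMap.rTensor_tmul, hε, Bialgebra.counit_mul,
    key, sweedler_smul, hψ.sweedler_counit_coalg, sweedler_counit_left, hρ.sweedler_counit, mul_one]

theorem smash_lTensor_counit (hρ : IsLeftComoduleCoalgebra ρ) (hψ : IsRightComoduleCoalgebra ψ)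
    (hδ : IsSmashComul ρ ψ τ δ)
    (hε : ∀ (a : A) (x : H) (b : B), ε (τ a x b) =
      counit (R := K) a * counit (R := K) x * counit (R := K) b)
    (a : A) (x : H) (b : B) : ε.lTensor V (δ (τ a x b)) = τ a x b ⊗ₜ[K] 1 := by
  -- The order `c₄, c₂, c₃, c₁` is dictated by the nesting: `c₃` sits on the innermost sum, over the
  -- coaction of `b₁`, where `c₄` and `c₂` are constants to be pulled out. Eliminating the sums from
  -- inside then works.
  have key : ∀ (c₁ c₂ c₃ c₄ : K) (v : V), v ⊗ₜ[K] (c₁ * (c₂ * c₃) * c₄) =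
      c₄ • c₂ • c₃ • c₁ • (v ⊗ₜ[K] (1 : K)) := fun c₁ c₂ c₃ c₄ v => by
    simp only [← TensorProduct.tmul_smul, smul_eq_mul, mul_one]
    congr 1
    ring
  simp (disch := fun_prop) only [hδ, map_sweedler, LinearMap.lTensor_tmul, hε, Bialgebra.counit_mul,
    key, sweedler_smul, hψ.sweedler_counit, sweedler_counit_right, hρ.sweedler_counit_coalg,
    one_mul]

end Units

/-! ### Multilinear maps and structures on a copy of the tensor product. -/

section Existence

/-- `V` is a bare vector space here and `W` is hidden behind the existential, which keeps the new
structures apart from the componentwise ones that `A ⊗ H ⊗ B` already carries. -/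
theorem exists_algebra_coalgebra.{t} {K : Type*} [Field K]
    {V : Type t} [AddCommGroup V] [Module K V]
    {μ : V →ₗ[K] V →ₗ[K] V} {e : V} {δ : V →ₗ[K] V ⊗[K] V} {ε : V →ₗ[K] K}
    (mul_assoc : ∀ u v w, μ (μ u v) w = μ u (μ v w)) (one_mul : ∀ v, μ e v = v)
    (mul_one : ∀ v, μ v e = v)
    (coassoc : ∀ v, TensorProduct.assoc K V V V (δ.rTensor V (δ v)) = δ.lTensor V (δ v))
    (rTensor_counit : ∀ v, ε.rTensor V (δ v) = 1 ⊗ₜ[K] v)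
    (lTensor_counit : ∀ v, ε.lTensor V (δ v) = v ⊗ₜ[K] 1) :
    ∃ (W : Type t) (_ : Ring W) (_ : Algebra K W) (_ : Coalgebra K W) (i : V ≃ₗ[K] W),
      i e = 1 ∧ (∀ u v, i u * i v = i (μ u v)) ∧
      (∀ v, comul (R := K) (i v) = TensorProduct.map i.toLinearMap i.toLinearMap (δ v)) ∧
      ∀ v, counit (R := K) (i v) = ε v := by
  let _ : Ring V :=
    { ‹AddCommGroup V› with
      mul := fun u v => μ u v
      one := e
      mul_assoc := mul_assoc
      one_mul := one_mul
      mul_one := mul_one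
      zero_mul := fun v => by
        change μ 0 v = 0
        simp
      mul_zero := fun v => by
        change μ v 0 = 0
        simp
      left_distrib := fun u v w => map_add (μ u) v w
      right_distrib := fun u v w => by
        change μ (u + v) w = μ u w + μ v w
        simp }
  let _ : Algebra K V := Algebra.ofModule (fun c u v => by
    change μ (c • u) v = c • μ u v
    simp) (fun c u v => map_smul (μ u) c v)
  let _ : Coalgebra K V :=
    { comul := δ
      counit := ε
      coassoc := LinearMap.ext coassoc
      rTensor_counit_comp_comul := LinearMap.ext rTensor_counit
      lTensor_counit_comp_comul := LinearMap.ext lTensor_counit }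
  refine ⟨V, inferInstance, inferInstance, inferInstance, LinearEquiv.refl K V, rfl,
    fun _ _ => rfl, fun v => ?_, fun _ => rfl⟩
  exact (LinearMap.congr_fun (TensorProduct.map_id (R := K) (M := V) (N := V)) _).symm

variable {K : Type*} [Field K] {M N L V P : Type*} [AddCommGroup M] [Module K M]
  [AddCommGroup N] [Module K N] [AddCommGroup L] [Module K L] [AddCommGroup V] [Module K V]
  [AddCommGroup P] [Module K P]

/-- The trilinear map underlying an identification of `M ⊗ N ⊗ L` with `V`. -/
noncomputable def trilinear (e : (M ⊗[K] N ⊗[K] L) ≃ₗ[K] V) : M →ₗ[K] N →ₗ[K] L →ₗ[K] V :=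
  TensorProduct.curry (TensorProduct.curry e.toLinearMap)

theorem trilinear_apply (e : (M ⊗[K] N ⊗[K] L) ≃ₗ[K] V) (m : M) (n : N) (l : L) :
    trilinear e m n l = e (m ⊗ₜ[K] n ⊗ₜ[K] l) := rfl

theorem trilinear_induction (e : (M ⊗[K] N ⊗[K] L) ≃ₗ[K] V) {p : V → Prop}
    (tmul : ∀ m n l, p (trilinear e m n l)) (add : ∀ u v, p u → p v → p (u + v)) (v : V) : p v := by
  obtain ⟨t, rfl⟩ := e.surjective v
  induction t with
  | zero => simpa [trilinear_apply] using tmul 0 0 0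
  | add u v hu hv => rw [map_add]; exact add _ _ hu hv
  | tmul t l =>
    induction t with
    | zero => simpa [trilinear_apply] using tmul 0 0 0
    | add u v hu hv => rw [TensorProduct.add_tmul, map_add]; exact add _ _ hu hv
    | tmul m n => exact tmul m n l

theorem exists_linearMap_trilinear (e : (M ⊗[K] N ⊗[K] L) ≃ₗ[K] V) {f : M → N → L → P}
    (h₁ : ∀ n l, IsLinearMap K fun m => f m n l) (h₂ : ∀ m l, IsLinearMap K fun n => f m n l)
    (h₃ : ∀ m n, IsLinearMap K fun l => f m n l) :
    ∃ F : V →ₗ[K] P, ∀ m n l, F (trilinear e m n l) = f m n l := by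
  let g : M ⊗[K] N → L → P := fun t l => sweedler K t fun m n => f m n l
  have hg₁ : ∀ l, IsLinearMap K fun t => g t l := fun l => by fun_prop
  have hg₂ : ∀ t, IsLinearMap K fun l => g t l := fun t => by fun_prop
  let G : (M ⊗[K] N) ⊗[K] L → P := fun t => sweedler K t g
  have hG : IsLinearMap K G := by fun_prop
  refine ⟨hG.mk'.comp e.symm.toLinearMap, fun m n l => ?_⟩
  simp (disch := fun_prop) [trilinear_apply, G, g, sweedler_of_tmul]

/-- Lift the last three variables first. Linear maps on `V` are determined on pure tensors, so the
lifted map depends linearly on each of the first three variables, which can then be lifted as well.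
-/
theorem exists_bilinearMap_trilinear (e : (M ⊗[K] N ⊗[K] L) ≃ₗ[K] V)
    {f : M → N → L → M → N → L → P}
    (h₁ : ∀ n l m' n' l', IsLinearMap K fun m => f m n l m' n' l')
    (h₂ : ∀ m l m' n' l', IsLinearMap K fun n => f m n l m' n' l')
    (h₃ : ∀ m n m' n' l', IsLinearMap K fun l => f m n l m' n' l')
    (h₄ : ∀ m n l n' l', IsLinearMap K fun m' => f m n l m' n' l')
    (h₅ : ∀ m n l m' l', IsLinearMap K fun n' => f m n l m' n' l')
    (h₆ : ∀ m n l m' n', IsLinearMap K fun l' => f m n l m' n' l') :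
    ∃ F : V →ₗ[K] V →ₗ[K] P, ∀ m n l m' n' l',
      F (trilinear e m n l) (trilinear e m' n' l') = f m n l m' n' l' := by
  choose G hG using fun m n l => exists_linearMap_trilinear e (h₄ m n l) (h₅ m n l) (h₆ m n l)
  have ext : ∀ {F F' : V →ₗ[K] P}, (∀ m n l, F (trilinear e m n l) = F' (trilinear e m n l)) →
      F = F' := fun {F F'} h => LinearMap.ext fun v =>
        trilinear_induction e (p := fun v => F v = F' v) h
        (fun u v hu hv => by rw [map_add, map_add, hu, hv]) v
  obtain ⟨F, hF⟩ := exists_linearMap_trilinear e (f := G)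
    (fun n l => ⟨fun x y => ext fun _ _ _ => by
        simp only [LinearMap.add_apply, hG, (h₁ _ _ _ _ _).map_add],
      fun c x => ext fun _ _ _ => by simp only [LinearMap.smul_apply, hG, (h₁ _ _ _ _ _).map_smul]⟩)
    (fun m l => ⟨fun x y => ext fun _ _ _ => by
        simp only [LinearMap.add_apply, hG, (h₂ _ _ _ _ _).map_add],
      fun c x => ext fun _ _ _ => by simp only [LinearMap.smul_apply, hG, (h₂ _ _ _ _ _).map_smul]⟩)
    (fun m n => ⟨fun x y => ext fun _ _ _ => by
        simp only [LinearMap.add_apply, hG, (h₃ _ _ _ _ _).map_add],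
      fun c x => ext fun _ _ _ => by simp only [LinearMap.smul_apply, hG, (h₃ _ _ _ _ _).map_smul]⟩)
  exact ⟨F, fun m n l m' n' l' => by rw [hF, hG]⟩

theorem trilinear_linearMap_ext (e : (M ⊗[K] N ⊗[K] L) ≃ₗ[K] V) {F F' : V →ₗ[K] P}
    (h : ∀ m n l, F (trilinear e m n l) = F' (trilinear e m n l)) (v : V) : F v = F' v :=
  trilinear_induction e (p := fun v => F v = F' v) h
    (fun u v hu hv => by rw [map_add, map_add, hu, hv]) v

theorem trilinear_bilinearMap_ext (e : (M ⊗[K] N ⊗[K] L) ≃ₗ[K] V) {F F' : V →ₗ[K] V →ₗ[K] P}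
    (h : ∀ m n l m' n' l', F (trilinear e m n l) (trilinear e m' n' l') =
      F' (trilinear e m n l) (trilinear e m' n' l')) (u v : V) : F u v = F' u v :=
  trilinear_linearMap_ext e (F := F u) (F' := F' u) (fun m' n' l' =>
    trilinear_linearMap_ext e (F := F.flip (trilinear e m' n' l'))
      (F' := F'.flip (trilinear e m' n' l')) (fun m n l => h m n l m' n' l') u) v

end Existence

/-! ### Existence of a realization. -/

section Realization

variable {K : Type*} [Field K] {H : Type v} [Ring H] [Bialgebra K H]
  {A : Type w} [Ring A] [Algebra K A] [Coalgebra K A]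
  {B : Type z} [Ring B] [Algebra K B] [Coalgebra K B]
  {lact : H →ₗ[K] A →ₗ[K] A} {σ : H →ₗ[K] H →ₗ[K] A}
  {ρ : A →ₗ[K] H ⊗[K] A} {ract : B →ₗ[K] H →ₗ[K] B} {ψ : B →ₗ[K] B ⊗[K] H}

theorem comul_linearMap_id (x : H) : comul (R := K) ((LinearMap.id : H →ₗ[K] H) x) =
    sweedler K (comul x) fun u v =>
      (LinearMap.id : H →ₗ[K] H) u ⊗ₜ[K] (LinearMap.id : H →ₗ[K] H) v :=
  (sweedler_tmul_self _).symm

set_option maxHeartbeats 400000 in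
theorem IsSetting.exists_structure {V : Type*} [AddCommGroup V] [Module K V]
    (hs : IsSetting lact σ ρ ract ψ) (e : (A ⊗[K] H ⊗[K] B) ≃ₗ[K] V) :
    ∃ (μ : V →ₗ[K] V →ₗ[K] V) (δ : V →ₗ[K] V ⊗[K] V) (ε : V →ₗ[K] K),
      IsCrossedMul lact σ ract (trilinear e) μ ∧ IsSmashComul ρ ψ (trilinear e) δ ∧
      (∀ (a : A) (x : H) (b : B), ε (trilinear e a x b) =
        counit (R := K) a * counit (R := K) x * counit (R := K) b) ∧
      (∀ u v w, μ (μ u v) w = μ u (μ v w)) ∧ (∀ v, μ (trilinear e 1 1 1) v = v) ∧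
      (∀ v, μ v (trilinear e 1 1 1) = v) ∧
      (∀ v, TensorProduct.assoc K V V V (δ.rTensor V (δ v)) = δ.lTensor V (δ v)) ∧
      (∀ v, ε.rTensor V (δ v) = 1 ⊗ₜ[K] v) ∧ ∀ v, ε.lTensor V (δ v) = v ⊗ₜ[K] 1 := by
  obtain ⟨μ, hμ⟩ := exists_bilinearMap_trilinear e (f := fun a x b a' x' b' =>
    sweedler K (comul x) fun x₁ y => sweedler K (comul y) fun x₂ x₃ =>
      sweedler K (comul x') fun x'₁ y' => sweedler K (comul y') fun x'₂ x'₃ =>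
        trilinear e (a * lact x₁ a' * σ x₂ x'₁) (x₃ * x'₂) (ract b x'₃ * b'))
    (by fun_prop) (by fun_prop) (by fun_prop) (by fun_prop) (by fun_prop) (by fun_prop)
  obtain ⟨δ, hδ⟩ := exists_linearMap_trilinear e (f := fun a x b =>
    sweedler K (comul a) fun a₁ a₂ => sweedler K (ρ a₂) fun h a₂₀ =>
      sweedler K (comul x) fun x₁ x₂ =>
        sweedler K (comul b) fun b₁ b₂ => sweedler K (ψ b₁) fun b₁₀ k =>
          trilinear e a₁ (h * x₁) b₁₀ ⊗ₜ[K] trilinear e a₂₀ (x₂ * k) b₂)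
    (by fun_prop) (by fun_prop) (by fun_prop)
  obtain ⟨ε, hε⟩ := exists_linearMap_trilinear e (f := fun a x b =>
    counit (R := K) a * counit (R := K) x * counit (R := K) b)
    (by fun_prop) (by fun_prop) (by fun_prop)
  replace hμ := fun a a' x x' b b' => hμ a x b a' x' b'
  refine ⟨μ, δ, ε, hμ, hδ, hε, fun u v w => ?_, fun v => ?_, fun v => ?_, fun v => ?_,
    fun v => ?_, fun v => ?_⟩
  · refine trilinear_bilinearMap_ext e (F := μ.compr₂ (μ.flip w))
      (F' := μ.compl₂ (μ.flip w)) (fun a x b a' x' b' => ?_) u v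
    refine trilinear_linearMap_ext e (F := μ (μ (trilinear e a x b) (trilinear e a' x' b')))
      (F' := (μ (trilinear e a x b)).comp (μ (trilinear e a' x' b'))) (fun a'' x'' b'' => ?_) w
    have key := crossed_mul_assoc (i := LinearMap.id) (j := LinearMap.id) (k := LinearMap.id)
      hs.act_left hs.cocycle hs.act_right hμ comul_linearMap_id comul_linearMap_id
      comul_linearMap_id a a' a'' x x' x'' b b' b''
    exact key
  · exact trilinear_linearMap_ext e (F := μ (trilinear e 1 1 1)) (F' := LinearMap.id)
      (crossed_one_mul hs.act_left hs.cocycle hs.act_right hμ) v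
  · exact trilinear_linearMap_ext e (F := μ.flip (trilinear e 1 1 1)) (F' := LinearMap.id)
      (crossed_mul_one hs.act_left hs.cocycle hs.act_right hμ) v
  · refine trilinear_linearMap_ext e
      (F := (TensorProduct.assoc K V V V).toLinearMap.comp ((δ.rTensor V).comp δ))
      (F' := (δ.lTensor V).comp δ) (fun a x b => ?_) v
    have key := smash_comul_coassoc (i := LinearMap.id) hs.coact_left hs.coact_right hδ
      comul_linearMap_id a x b
    simpa only [LinearMap.id_apply, LinearMap.comp_apply, LinearEquiv.coe_coe] using key
  · have key := smash_rTensor_counit (τ := trilinear e) hs.coact_left hs.coact_right hδ hε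
    exact trilinear_linearMap_ext e (F := (ε.rTensor V).comp δ) (F' := TensorProduct.mk K K V 1)
      key v
  · have key := smash_lTensor_counit (τ := trilinear e) hs.coact_left hs.coact_right hδ hε
    exact trilinear_linearMap_ext e (F := (ε.lTensor V).comp δ)
      (F' := (TensorProduct.mk K V K).flip 1) key v

theorem trilinear_trans {V W : Type*} [AddCommGroup V] [Module K V] [AddCommGroup W] [Module K W]
    (e : (A ⊗[K] H ⊗[K] B) ≃ₗ[K] V) (i : V ≃ₗ[K] W) (a : A) (x : H) (b : B) :
    trilinear (e.trans i) a x b = i (trilinear e a x b) := rfl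

theorem IsSetting.exists_realization_of_equiv.{t} {V : Type t} [AddCommGroup V] [Module K V]
    (hs : IsSetting lact σ ρ ract ψ) (e : (A ⊗[K] H ⊗[K] B) ≃ₗ[K] V) :
    ∃ (W : Type t) (_ : Ring W) (_ : Algebra K W) (_ : Coalgebra K W)
      (i : (A ⊗[K] H ⊗[K] B) ≃ₗ[K] W), IsRealization lact σ ρ ract ψ (trilinear i) := by
  obtain ⟨μ, δ, ε, hμ, hδ, hε, h₁, h₂, h₃, h₄, h₅, h₆⟩ := hs.exists_structure e
  obtain ⟨W, _, _, _, i, hone, hmul, hcomul, hcounit⟩ := exists_algebra_coalgebra h₁ h₂ h₃ h₄ h₅ h₆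
  refine ⟨W, inferInstance, inferInstance, inferInstance, e.trans i,
    trilinear_induction (e.trans i), hone, fun a a' x x' b b' => ?_, fun a x b => ?_,
    fun a x b => ?_⟩
  · simp only [trilinear_trans, hmul, hμ, equiv_sweedler]
  · simp only [trilinear_trans, hcomul, hδ, map_sweedler, TensorProduct.map_tmul,
      LinearEquiv.coe_coe]
  · rw [trilinear_trans, hcounit, hε]

theorem IsSetting.exists_realization (hs : IsSetting lact σ ρ ract ψ) :
    ∃ (W : Type (max v w z)) (_ : Ring W) (_ : Algebra K W) (_ : Coalgebra K W)
      (i : (A ⊗[K] H ⊗[K] B) ≃ₗ[K] W), IsRealization lact σ ρ ract ψ (trilinear i) :=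
  hs.exists_realization_of_equiv (LinearEquiv.refl K (A ⊗[K] H ⊗[K] B))

end Realization

/-! ### Necessity: projections by counits and the normalization conditions. -/

section Necessity

variable {K : Type*} [Field K] {H : Type*} [Ring H] [Bialgebra K H]
  {A : Type*} [Ring A] [Algebra K A] [Coalgebra K A]
  {B : Type*} [Ring B] [Algebra K B] [Coalgebra K B]
  {W : Type*} [Ring W] [Algebra K W] [Coalgebra K W]
  {lact : H →ₗ[K] A →ₗ[K] A} {σ : H →ₗ[K] H →ₗ[K] A}
  {ρ : A →ₗ[K] H ⊗[K] A} {ract : B →ₗ[K] H →ₗ[K] B} {ψ : B →ₗ[K] B ⊗[K] H}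
  {τ : A →ₗ[K] H →ₗ[K] B →ₗ[K] W}

/-- The linear projections of `A ⊗ H ⊗ B` to `A`, `H`, `B` and `A ⊗ H` given by the counits. -/
structure IsProjections (τ : A →ₗ[K] H →ₗ[K] B →ₗ[K] W) (p : W →ₗ[K] A) (q : W →ₗ[K] H)
    (r : W →ₗ[K] B) (s : W →ₗ[K] A ⊗[K] H) : Prop where
  left : ∀ a x b, p (τ a x b) = counit (R := K) x • counit (R := K) b • a
  mid : ∀ a x b, q (τ a x b) = counit (R := K) a • counit (R := K) b • x
  right : ∀ a x b, r (τ a x b) = counit (R := K) a • counit (R := K) x • b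
  left_mid : ∀ a x b, s (τ a x b) = counit (R := K) b • a ⊗ₜ[K] x

theorem IsProjections.apply {p : W →ₗ[K] A} {q : W →ₗ[K] H} {r : W →ₗ[K] B} {s : W →ₗ[K] A ⊗[K] H}
    (hp : IsProjections τ p q r s) :
    (∀ a x b, p (τ a x b) = counit (R := K) x • counit (R := K) b • a) ∧
      (∀ a x b, q (τ a x b) = counit (R := K) a • counit (R := K) b • x) ∧
      (∀ a x b, r (τ a x b) = counit (R := K) a • counit (R := K) x • b) ∧
      ∀ a x b, s (τ a x b) = counit (R := K) b • a ⊗ₜ[K] x :=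
  ⟨hp.left, hp.mid, hp.right, hp.left_mid⟩

theorem exists_isProjections (e : (A ⊗[K] H ⊗[K] B) ≃ₗ[K] W) :
    ∃ p q r s, IsProjections (trilinear e) p q r s := by
  obtain ⟨p, hp⟩ := exists_linearMap_trilinear e
    (f := fun a x b => counit (R := K) x • counit (R := K) b • a)
    (by fun_prop) (by fun_prop) (by fun_prop)
  obtain ⟨q, hq⟩ := exists_linearMap_trilinear e
    (f := fun a x b => counit (R := K) a • counit (R := K) b • x)
    (by fun_prop) (by fun_prop) (by fun_prop)
  obtain ⟨r, hr⟩ := exists_linearMap_trilinear e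
    (f := fun a x b => counit (R := K) a • counit (R := K) x • b)
    (by fun_prop) (by fun_prop) (by fun_prop)
  obtain ⟨s, hs⟩ := exists_linearMap_trilinear e
    (f := fun a x b => counit (R := K) b • a ⊗ₜ[K] x)
    (by fun_prop) (by fun_prop) (by fun_prop)
  exact ⟨p, q, r, s, hp, hq, hr, hs⟩

namespace IsRealization

theorem mul_right_mid (he : IsRealization lact σ ρ ract ψ τ) (hs : IsSetting lact σ ρ ract ψ)
    (x : H) (b : B) : τ 1 1 b * τ 1 x 1 =
      sweedler K (Coalgebra.comul x) fun x₁ x₂ => τ 1 x₁ (ract b x₂) := by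
  simp (disch := fun_prop) only [he.mul, sweedler_of_tmul, Bialgebra.comul_one,
    Algebra.TensorProduct.one_def, hs.act_left.one_act, hs.cocycle.left_one, one_mul, mul_one,
    map_smul, LinearMap.smul_apply, sweedler_counit_left, sweedler_smul]

variable {p : W →ₗ[K] A} {q : W →ₗ[K] H} {r : W →ₗ[K] B} {s : W →ₗ[K] A ⊗[K] H}

/-- Conditions on units come from projecting `Δ(1) = 1 ⊗ 1`, those on counits from `ε(uv) =
ε(u)ε(v)` on generators. They are isolated because the coproducts of generators simplify only once
these hold. -/
theorem isNormalized (he : IsRealization lact σ ρ ract ψ τ) (hs : IsSetting lact σ ρ ract ψ)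
    (hp : IsProjections τ p q r s)
    (comul_one : Coalgebra.comul (R := K) (1 : W) = 1 ⊗ₜ[K] 1)
    (counit_mul : ∀ u v : W, Coalgebra.counit (R := K) (u * v) =
      Coalgebra.counit (R := K) u * Coalgebra.counit (R := K) v) :
    IsNormalized lact ρ ract ψ where
  counit_mul_left a a' := by
    have key := counit_mul (τ a 1 1) (τ a' 1 1)
    simpa only [he.left_mul hs, he.counit_apply, Bialgebra.counit_one, hs.counit_one_right,
      mul_one] using key
  counit_mul_right b b' := by
    have key := counit_mul (τ 1 1 b) (τ 1 1 b')
    simpa only [he.mul_right hs, he.counit_apply, Bialgebra.counit_one, hs.counit_one_left,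
      one_mul] using key
  comul_one_left := by
    have key := congrArg (TensorProduct.map p p) comul_one
    rw [← he.one, he.comul_apply] at key
    simpa (disch := fun_prop) only [map_sweedler, TensorProduct.map_tmul, hp.apply, hs.counit_laws,
      comul_one_eq_tmul, sweedler_of_tmul, Bialgebra.counit_mul, Bialgebra.counit_one, one_smul,
      one_mul, mul_one, TensorProduct.tmul_smul, ← TensorProduct.smul_tmul', sweedler_smul,
      sweedler_tmul_self, sweedler_counit_left, sweedler_counit_right,
      hs.coact_left.sweedler_counit, hs.coact_right.sweedler_counit,
      hs.coact_left.sweedler_counit_coalg, hs.coact_right.sweedler_counit_coalg] using key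
  comul_one_right := by
    have key := congrArg (TensorProduct.map r r) comul_one
    rw [← he.one, he.comul_apply] at key
    simpa (disch := fun_prop) only [map_sweedler, TensorProduct.map_tmul, hp.apply, hs.counit_laws,
      comul_one_eq_tmul, sweedler_of_tmul, Bialgebra.counit_mul, Bialgebra.counit_one, one_smul,
      one_mul, mul_one, TensorProduct.tmul_smul, ← TensorProduct.smul_tmul', sweedler_smul,
      sweedler_tmul_self, sweedler_counit_left, sweedler_counit_right,
      hs.coact_left.sweedler_counit, hs.coact_right.sweedler_counit,
      hs.coact_left.sweedler_counit_coalg, hs.coact_right.sweedler_counit_coalg] using key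
  coact_one_left := by
    have key := congrArg (TensorProduct.map q p) comul_one
    rw [← he.one, he.comul_apply] at key
    simpa (disch := fun_prop) only [map_sweedler, TensorProduct.map_tmul, hp.apply, hs.counit_laws,
      comul_one_eq_tmul, sweedler_of_tmul, Bialgebra.counit_mul, Bialgebra.counit_one, one_smul,
      one_mul, mul_one, TensorProduct.tmul_smul, ← TensorProduct.smul_tmul', sweedler_smul,
      sweedler_tmul_self, sweedler_counit_left, sweedler_counit_right,
      hs.coact_left.sweedler_counit, hs.coact_right.sweedler_counit,
      hs.coact_left.sweedler_counit_coalg, hs.coact_right.sweedler_counit_coalg] using key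
  coact_one_right := by
    have key := congrArg (TensorProduct.map r q) comul_one
    rw [← he.one, he.comul_apply] at key
    simpa (disch := fun_prop) only [map_sweedler, TensorProduct.map_tmul, hp.apply, hs.counit_laws,
      comul_one_eq_tmul, sweedler_of_tmul, Bialgebra.counit_mul, Bialgebra.counit_one, one_smul,
      one_mul, mul_one, TensorProduct.tmul_smul, ← TensorProduct.smul_tmul', sweedler_smul,
      sweedler_tmul_self, sweedler_counit_left, sweedler_counit_right,
      hs.coact_left.sweedler_counit, hs.coact_right.sweedler_counit,
      hs.coact_left.sweedler_counit_coalg, hs.coact_right.sweedler_counit_coalg] using key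
  counit_act_left x a := by
    have key := counit_mul (τ 1 x 1) (τ a 1 1)
    simp (disch := fun_prop) only [he.mid_mul_left hs, map_sweedler, he.counit_apply] at key
    have aux := sweedler_counit_right (K := K) x
      (f := fun x => counit (R := K) (lact x a)) (by fun_prop)
    rw [← aux]
    simpa only [Bialgebra.counit_one, hs.counit_one_right, hs.counit_one_left, one_mul, mul_one,
      smul_eq_mul, mul_comm] using key
  counit_act_right b x := by
    have key := counit_mul (τ 1 1 b) (τ 1 x 1)
    simp (disch := fun_prop) only [he.mul_right_mid hs, map_sweedler, he.counit_apply] at key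
    have aux := sweedler_counit_left (K := K) x
      (f := fun x => counit (R := K) (ract b x)) (by fun_prop)
    rw [← aux]
    simpa only [Bialgebra.counit_one, hs.counit_one_right, hs.counit_one_left, one_mul, mul_one,
      smul_eq_mul] using key

end IsRealization

end Necessity

/-! ### Necessity: the remaining conditions. -/

section Necessity

variable {K : Type*} [Field K] {H : Type*} [Ring H] [Bialgebra K H]
  {A : Type*} [Ring A] [Algebra K A] [Coalgebra K A]
  {B : Type*} [Ring B] [Algebra K B] [Coalgebra K B]
  {W : Type*} [Ring W] [Algebra K W] [Coalgebra K W]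
  {lact : H →ₗ[K] A →ₗ[K] A} {σ : H →ₗ[K] H →ₗ[K] A}
  {ρ : A →ₗ[K] H ⊗[K] A} {ract : B →ₗ[K] H →ₗ[K] B} {ψ : B →ₗ[K] B ⊗[K] H}
  {τ : A →ₗ[K] H →ₗ[K] B →ₗ[K] W}
  {p : W →ₗ[K] A} {q : W →ₗ[K] H} {r : W →ₗ[K] B} {s : W →ₗ[K] A ⊗[K] H}

/-- This eliminates the coaction on `a` from the raw form of (E3). Cancelling it by (D21) requires
`k ▷ a₀` to stand alone, so `x₂ k₂ ▷ a₀` must be split; the twisted module law does this at the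
price of a cocycle, which (D20) both supplies and takes away. -/
theorem IsSetting.sweedler_act_coact (hs : IsSetting lact σ ρ ract ψ)
    (h20 : ∀ (b : B) (x : H), (sweedler K (ψ b) fun b₀ k => b₀ ⊗ₜ[K] (1 : A) ⊗ₜ[K] (x * k)) =
      sweedler K (ψ b) fun b₀ k => sweedler K (comul k) fun k₁ k₂ =>
        sweedler K (comul x) fun x₁ x₂ => b₀ ⊗ₜ[K] σ x₁ k₁ ⊗ₜ[K] (x₂ * k₂))
    (h21 : ∀ (a : A) (b : B), (sweedler K (ρ a) fun h a₀ => sweedler K (ψ b) fun b₀ k =>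
      lact k a₀ ⊗ₜ[K] ract b₀ h) = a ⊗ₜ[K] b)
    {P : Type*} [AddCommGroup P] [Module K P] (a : A) (b : B) (x w : H) {f : B → A → P}
    (h₁ : ∀ a, IsLinearMap K fun b => f b a) (h₂ : ∀ b, IsLinearMap K fun a => f b a) :
    (sweedler K (ψ b) fun m k => sweedler K (ρ a) fun h a₀ => sweedler K (comul (x * k)) fun y z =>
      f (ract m h) (lact y a₀ * σ z w)) =
    sweedler K (comul x) fun x₁ x₂ => sweedler K (ψ b) fun b₀ k =>
      f b₀ (lact x₁ a * σ (x₂ * k) w) := by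
  -- Insert `σ(x₁, k₁)` by (D20).
  have S₁ := sweedler_congr (t := ρ a) fun h a₀ =>
    sweedler_of_cocycle_coact_right (h20 b x) (f := fun m c y => sweedler K (comul y) fun y z =>
      f (ract m h) (c * (lact y a₀ * σ z w))) (by fun_prop) (by fun_prop) (by fun_prop)
  -- Read from right to left: `σ(x₁, k₁) (x₂ k₂ ▷ a₀)` becomes `(x₁ ▷ (k₁ ▷ a₀)) σ(x₂, k₂)`.
  have S₂ := sweedler_congr (t := ρ a) fun h a₀ => sweedler_congr (t := ψ b) fun m k =>
    hs.cocycle.sweedler_twisted_module (i := LinearMap.id) (j := LinearMap.id) comul_linearMap_id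
      comul_linearMap_id x k a₀ (f := fun c u v => f (ract m h) (c * σ (u * v) w))
      (by fun_prop) (by fun_prop) (by fun_prop)
  -- Also read from right to left: (D20) deletes the cocycle, now applied to an already coacted
  -- component of `b`.
  have S₃ := sweedler_congr (t := ρ a) fun h a₀ =>
    sweedler_congr (t := comul (R := K) x) fun x₁ u =>
    sweedler_of_cocycle_coact_right (h20 b u) (f := fun m' c y => sweedler K (ψ m') fun m k =>
      f (ract m h) (lact x₁ (lact k a₀) * (c * σ y w))) (by fun_prop) (by fun_prop) (by fun_prop)
  -- (D21) collapses the remaining mutual action of `a` and that component.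
  have S₄ := sweedler_congr (t := comul (R := K) x) fun x₁ u => sweedler_congr (t := ψ b) fun m v =>
    sweedler_of_double_biproduct (h21 a m) (f := fun c m => f m (lact x₁ c * σ (u * v) w))
      (by fun_prop) (by fun_prop)
  simp (disch := fun_prop) only [LinearMap.id_apply, one_mul, mul_assoc, sweedler_comul_mul]
    at S₁ S₂ S₃ ⊢
  rw [← S₄]
  refine (sweedler_comm _ _ _).trans (S₁.trans (Eq.trans ?_ (S₂.symm.trans (Eq.trans ?_
    (S₃.symm.trans ((sweedler_comm _ _ _).trans
      (sweedler_congr fun x₁ u => sweedler_comm _ _ _)))))))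
  · refine sweedler_congr fun h a₀ => sweedler_congr fun m k => Eq.trans (sweedler_comm _ _ _) ?_
    exact sweedler_congr fun x₁ x₂ => sweedler_comm _ _ _
  · refine sweedler_congr fun h a₀ => Eq.trans (sweedler_comm _ _ _) (sweedler_congr fun x₁ u => ?_)
    refine Eq.trans (sweedler_congr fun m k => Eq.trans (sweedler_comm _ _ _)
      (sweedler_congr fun y₁ v => sweedler_comm _ _ _)) ?_
    refine (hs.coact_right.sweedler_coassoc b (f := fun m y₁ v => sweedler K (comul v) fun y₂ y₃ =>
      sweedler K (comul u) fun x₂ x₃ =>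
        f (ract m h) (lact x₁ (lact y₁ a₀) * (σ x₂ y₂ * σ (x₃ * y₃) w))) (by fun_prop) (by fun_prop)
        (by fun_prop)).trans ?_
    refine sweedler_congr fun m' v => Eq.trans (sweedler_comm _ _ _)
      (sweedler_congr fun y₂ y₃ => sweedler_comm _ _ _)

namespace IsRealization

set_option maxHeartbeats 1000000 in
/-- The compatibility conditions are necessary for the comultiplication and the counit to be
multiplicative. -/
theorem biproductConditions (he : IsRealization lact σ ρ ract ψ τ) (hs : IsSetting lact σ ρ ract ψ)
    (hp : IsProjections τ p q r s) (comul_one : Coalgebra.comul (R := K) (1 : W) = 1 ⊗ₜ[K] 1)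
    (counit_mul : ∀ u v : W, Coalgebra.counit (R := K) (u * v) =
      Coalgebra.counit (R := K) u * Coalgebra.counit (R := K) v)
    (hm : ∀ u v : W, ComulMul K u v) : BiproductConditions lact σ ρ ract ψ := by
  have hn := he.isNormalized hs hp comul_one counit_mul
  -- The maps `p`, `q`, `r` retain the leg in `A`, `H`, `B`. Only (C5) and (D20) need `s`, since
  -- there one tensor factor must retain both its legs in `A` and in `H`.
  have key_twisted_comodule_cocycle := fun (a : A) (x : H) =>
    congrArg (TensorProduct.map s p) (hm (τ a 1 1) (τ 1 x 1))
  have key_cocycle_coact_right := fun (x : H) (b : B) =>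
    congrArg (TensorProduct.map r s) (hm (τ 1 x 1) (τ 1 1 b))
  have key_comul_mul_left := fun (a a' : A) =>
    congrArg (TensorProduct.map p p) (hm (τ a 1 1) (τ a' 1 1))
  have key_coact_mul_left := fun (a a' : A) =>
    congrArg (TensorProduct.map q p) (hm (τ a 1 1) (τ a' 1 1))
  have key_coact_mul_right := fun (b b' : B) =>
    congrArg (TensorProduct.map r q) (hm (τ 1 1 b) (τ 1 1 b'))
  have key_comul_mul_right := fun (b b' : B) =>
    congrArg (TensorProduct.map r r) (hm (τ 1 1 b) (τ 1 1 b'))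
  have key_coact_cocycle := fun (x x' : H) =>
    congrArg (TensorProduct.map q p) (hm (τ 1 x 1) (τ 1 x' 1))
  have key_comul_cocycle := fun (x x' : H) =>
    congrArg (TensorProduct.map p p) (hm (τ 1 x 1) (τ 1 x' 1))
  have key_comul_act_left := fun (x : H) (a : A) =>
    congrArg (TensorProduct.map p p) (hm (τ 1 x 1) (τ a 1 1))
  have key_yetterDrinfeld_left := fun (x : H) (a : A) =>
    congrArg (TensorProduct.map q p) (hm (τ 1 x 1) (τ a 1 1))
  have key_yetterDrinfeld_right := fun (b : B) (x : H) =>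
    congrArg (TensorProduct.map r q) (hm (τ 1 1 b) (τ 1 x 1))
  have key_comul_act_right := fun (b : B) (x : H) =>
    congrArg (TensorProduct.map r r) (hm (τ 1 1 b) (τ 1 x 1))
  have key_double_biproduct := fun (a : A) (b : B) =>
    congrArg (TensorProduct.map r p) (hm (τ 1 1 b) (τ a 1 1))
  have key_cocycle_act_coact := fun (a : A) (x x' : H) (b b' : B) =>
    congrArg (TensorProduct.map r p) (hm (τ 1 x b) (τ a x' b'))
  simp only [he.comul_left hn, he.comul_mid hn, he.comul_right hn, sweedler_mul]
    at key_twisted_comodule_cocycle key_cocycle_coact_right key_comul_mul_left key_coact_mul_left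
      key_coact_mul_right key_comul_mul_right key_coact_cocycle key_comul_cocycle
      key_comul_act_left key_yetterDrinfeld_left key_yetterDrinfeld_right key_comul_act_right
      key_double_biproduct
  simp (disch := fun_prop) only [he.comul_apply, sweedler_mul, sweedler_of_tmul, hn.one_laws,
    one_mul] at key_cocycle_act_coact
  simp only [mul_sweedler, Algebra.TensorProduct.tmul_mul_tmul, he.left_mul hs, he.mul_right hs,
    he.mid_mul_left hs, he.mul_right_mid hs, he.right_mul_left hs]
    at key_twisted_comodule_cocycle key_cocycle_coact_right key_comul_mul_left key_coact_mul_left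
      key_coact_mul_right key_comul_mul_right key_coact_cocycle key_comul_cocycle
      key_comul_act_left key_yetterDrinfeld_left key_yetterDrinfeld_right key_comul_act_right
      key_double_biproduct key_cocycle_act_coact
  simp (disch := fun_prop) only [he.comul_apply, he.mul, map_sweedler, TensorProduct.map_tmul,
    hp.apply, hn.counit_laws, hn.one_laws, hs.one_laws, hs.counit_laws, comul_one_eq_tmul,
    sweedler_of_tmul, Bialgebra.counit_mul, Bialgebra.counit_one, one_smul, one_mul, mul_one,
    mul_smul_comm, smul_mul_assoc, mul_smul, TensorProduct.tmul_smul, ← TensorProduct.smul_tmul',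
    map_smul, LinearMap.smul_apply, sweedler_smul, sweedler_tmul_self, sweedler_counit_left,
    sweedler_counit_right, hs.coact_left.sweedler_counit, hs.coact_right.sweedler_counit]
    at key_twisted_comodule_cocycle key_cocycle_coact_right key_comul_mul_left key_coact_mul_left
      key_coact_mul_right key_comul_mul_right key_coact_cocycle key_comul_cocycle
      key_comul_act_left key_yetterDrinfeld_left key_yetterDrinfeld_right key_comul_act_right
      key_double_biproduct key_cocycle_act_coact
  have h20 : ∀ (b : B) (x : H), (sweedler K (ψ b) fun b₀ k => b₀ ⊗ₜ[K] (1 : A) ⊗ₜ[K] (x * k)) =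
      sweedler K (ψ b) fun b₀ k => sweedler K (comul k) fun k₁ k₂ =>
        sweedler K (comul x) fun x₁ x₂ => b₀ ⊗ₜ[K] σ x₁ k₁ ⊗ₜ[K] (x₂ * k₂) := fun b x => by
    have key' := congrArg (TensorProduct.assoc K B A H).symm (key_cocycle_coact_right x b)
    simp only [equiv_sweedler, TensorProduct.assoc_symm_tmul, tmul_sweedler] at key'
    exact key'.trans (sweedler_congr fun _ _ => sweedler_comm _ _ _)
  have h21 : ∀ (a : A) (b : B), (sweedler K (ρ a) fun h a₀ => sweedler K (ψ b) fun b₀ k =>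
        lact k a₀ ⊗ₜ[K] ract b₀ h) = a ⊗ₜ[K] b := fun a b => by
    have key' := congrArg (TensorProduct.comm K B A) (key_double_biproduct a b)
    simp only [equiv_sweedler, TensorProduct.comm_tmul] at key'
    exact (key'.trans (sweedler_comm _ _ _)).symm
  exact
    { counit_alg_left := ⟨hs.counit_one_left, hn.counit_mul_left⟩
      counit_alg_right := ⟨hs.counit_one_right, hn.counit_mul_right⟩
      comul_one_left := hn.comul_one_left
      comul_one_right := hn.comul_one_right
      coact_one_left := hn.coact_one_left
      coact_one_right := hn.coact_one_right
      counit_act_left := hn.counit_act_left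
      counit_act_right := hn.counit_act_right
      twisted_comodule_cocycle := fun a x => by
        simpa only [sweedler_tmul] using key_twisted_comodule_cocycle a x
      cocycle_coact_right := h20
      comul_mul_left := fun a a' => by
        rw [key_comul_mul_left]
        simp only [sweedler_tmul, sweedler_comm (M := A) (N := A) (Q := H) (R := H),
          sweedler_comm (M := H) (N := A) (Q := H) (R := H)]
      coact_mul_left := key_coact_mul_left
      coact_mul_right := key_coact_mul_right
      comul_mul_right := key_comul_mul_right
      coact_cocycle := fun x x' => by
        simpa only [mul_assoc] using key_coact_cocycle x x'
      comul_cocycle := key_comul_cocycle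
      comul_act_left := fun x a => by
        rw [key_comul_act_left]
        simp (disch := fun_prop) only [sweedler_tmul,
          sweedler_comm (M := A) (N := A) (Q := H) (R := H),
          sweedler_comm (M := H) (N := A) (Q := H) (R := H), sweedler_coassoc]
      yetterDrinfeld_left := key_yetterDrinfeld_left
      yetterDrinfeld_right := fun b x =>
        (key_yetterDrinfeld_right b x).trans (sweedler_comm _ _ _)
      comul_act_right := key_comul_act_right
      double_biproduct := h21
      cocycle_act_coact := fun a x x' b b' => by
        have key := key_cocycle_act_coact a x x' b b'
        -- The raw identity has `(b₍₀₎ ◁ a₋₁) ◁ x'₁` and `((x b₍₁₎)₁ ▷ a₀) σ((x b₍₁₎)₂, x'₂ b'₍₁₎)`,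
        -- so the elimination lemma applies with `w = x'₂ b'₍₁₎`.
        have S := sweedler_congr (t := Coalgebra.comul (R := K) x') fun u v =>
          sweedler_congr (t := ψ b') fun c l => hs.sweedler_act_coact h20 h21 a b x (v * l)
            (f := fun b a => (ract b u * c) ⊗ₜ[K] a) (by fun_prop) (by fun_prop)
        simp only [tmul_sweedler, hs.act_right.act_mul] at key
        refine key.trans (Eq.trans ?_ (S.trans ?_))
        · refine Eq.trans (sweedler_congr fun m k => Eq.trans (sweedler_comm _ _ _)
            (sweedler_congr fun u v => sweedler_comm _ _ _)) ?_
          exact Eq.trans (sweedler_comm _ _ _) (sweedler_congr fun u v => sweedler_comm _ _ _)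
        · refine Eq.trans (sweedler_congr fun u v => Eq.trans (sweedler_comm _ _ _)
            (sweedler_congr fun x₁ x₂ => sweedler_comm _ _ _)) ?_
          exact sweedler_comm _ _ _ }

end IsRealization

end Necessity

/-! ### The equivalence. -/

section Characterization

variable {K : Type*} [Field K] {H : Type v} [Ring H] [Bialgebra K H]
  {A : Type w} [Ring A] [Algebra K A] [Coalgebra K A]
  {B : Type z} [Ring B] [Algebra K B] [Coalgebra K B]
  {lact : H →ₗ[K] A →ₗ[K] A} {σ : H →ₗ[K] H →ₗ[K] A}
  {ρ : A →ₗ[K] H ⊗[K] A} {ract : B →ₗ[K] H →ₗ[K] B} {ψ : B →ₗ[K] B ⊗[K] H}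

theorem equiv_crossedMul {V : Type*} [AddCommGroup V] [Module K V]
    (e : (A ⊗[K] H ⊗[K] B) ≃ₗ[K] V) (a : A) (x : H) (b : B) (a' : A) (x' : H) (b' : B) :
    e (crossedMul lact σ ract a x b a' x' b') =
      sweedler K (comul x) fun x₁ y => sweedler K (comul y) fun x₂ x₃ =>
        sweedler K (comul x') fun x'₁ y' => sweedler K (comul y') fun x'₂ x'₃ =>
          trilinear e (a * lact x₁ a' * σ x₂ x'₁) (x₃ * x'₂) (ract b x'₃ * b') := by
  simp only [crossedMul, equiv_sweedler, trilinear_apply]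

theorem map_equiv_sweedler {M N X V : Type*} [AddCommGroup M] [Module K M] [AddCommGroup N]
    [Module K N] [AddCommGroup X] [Module K X] [AddCommGroup V] [Module K V] (e : X ≃ₗ[K] V)
    (t : M ⊗[K] N) (f : M → N → X ⊗[K] X) :
    TensorProduct.map e.toLinearMap e.toLinearMap (sweedler K t f) =
      sweedler K t fun m n => TensorProduct.map e.toLinearMap e.toLinearMap (f m n) :=
  map_sweedler _ _ _

theorem map_smashComul {V : Type*} [AddCommGroup V] [Module K V]
    (e : (A ⊗[K] H ⊗[K] B) ≃ₗ[K] V) (a : A) (x : H) (b : B) :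
    TensorProduct.map e.toLinearMap e.toLinearMap (smashComul ρ ψ a x b) =
      sweedler K (comul a) fun a₁ a₂ => sweedler K (ρ a₂) fun h a₂₀ =>
        sweedler K (comul x) fun x₁ x₂ =>
          sweedler K (comul b) fun b₁ b₂ => sweedler K (ψ b₁) fun b₁₀ k =>
            trilinear e a₁ (h * x₁) b₁₀ ⊗ₜ[K] trilinear e a₂₀ (x₂ * k) b₂ := by
  refine (map_equiv_sweedler e _ _).trans (sweedler_congr fun a₁ a₂ => ?_)
  refine (map_equiv_sweedler e _ _).trans (sweedler_congr fun h a₂₀ => ?_)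
  refine (map_equiv_sweedler e _ _).trans (sweedler_congr fun x₁ x₂ => ?_)
  refine (map_equiv_sweedler e _ _).trans (sweedler_congr fun b₁ b₂ => ?_)
  exact map_equiv_sweedler e _ _

theorem isBiproductBialgebra_iff_exists : IsBiproductBialgebra lact σ ρ ract ψ ↔
    ∃ (W : Type (max v w z)) (_ : Ring W) (_ : Bialgebra K W) (e : (A ⊗[K] H ⊗[K] B) ≃ₗ[K] W),
      IsRealization lact σ ρ ract ψ (trilinear e) := by
  refine exists_congr fun W => exists_congr fun _ => exists_congr fun _ => exists_congr fun e => ?_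
  constructor
  · rintro ⟨hone, hmul, hcomul, hcounit⟩
    exact ⟨trilinear_induction e, hone,
      fun a a' x x' b b' => (hmul a a' x x' b b').trans (equiv_crossedMul e a x b a' x' b'),
      fun a x b => (hcomul a x b).trans (map_smashComul e a x b), hcounit⟩
  · intro he
    exact ⟨he.one,
      fun a a' x x' b b' => (he.mul a a' x x' b b').trans (equiv_crossedMul e a x b a' x' b').symm,
      fun a x b => (he.comul_apply a x b).trans (map_smashComul e a x b).symm, he.counit_apply⟩

theorem IsSetting.isBiproductBialgebra_iff (hs : IsSetting lact σ ρ ract ψ) :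
    IsBiproductBialgebra lact σ ρ ract ψ ↔ BiproductConditions lact σ ρ ract ψ := by
  rw [isBiproductBialgebra_iff_exists]
  constructor
  · rintro ⟨W, _, _, e, he⟩
    obtain ⟨p, q, r, s, hp⟩ := exists_isProjections e
    exact he.biproductConditions hs hp Bialgebra.comul_one Bialgebra.counit_mul Bialgebra.comul_mul
  · intro h
    obtain ⟨W, _, _, _, e, he⟩ := hs.exists_realization
    -- The realization is so far only an algebra and a coalgebra; the conditions enter here, to make
    -- `Δ` and `ε` algebra maps.
    let _ : Bialgebra K W := Bialgebra.mk' K W (he.counit_one h)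
      (fun {u v} => he.counit_mul hs h u v)
      (he.comul_one h) (fun {u v} => he.comul_mul hs h u v)
    exact ⟨W, inferInstance, inferInstance, e, he⟩

end Characterization

end CrossedBiproduct

theorem proposition3p4 {K : Type*} [Field K] {H : Type*} [Ring H] [Bialgebra K H]
    {A : Type*} [Ring A] [Algebra K A] [Coalgebra K A]
    {B : Type*} [Ring B] [Algebra K B] [Coalgebra K B]
    (lact : H →ₗ[K] A →ₗ[K] A) (σ : H →ₗ[K] H →ₗ[K] A) (ρ : A →ₗ[K] H ⊗[K] A)
    (ract : B →ₗ[K] H →ₗ[K] B) (ψ : B →ₗ[K] B ⊗[K] H)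
    (hρ : CrossedBiproduct.IsLeftComoduleCoalgebra ρ)
    (hA : counit (R := K) (1 : A) = 1)
    (hσε : ∀ x x' : H, counit (R := K) (σ x x') = counit (R := K) x * counit (R := K) x')
    (hlact : CrossedBiproduct.IsLeftWeakAction lact)
    (hσ : CrossedBiproduct.IsCrossedCocycle lact σ)
    (hract : CrossedBiproduct.IsRightModuleAlgebra ract)
    (hψ : CrossedBiproduct.IsRightComoduleCoalgebra ψ)
    (hB : counit (R := K) (1 : B) = 1) :
    CrossedBiproduct.IsBiproductBialgebra lact σ ρ ract ψ ↔
      CrossedBiproduct.BiproductConditions lact σ ρ ract ψ :=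
  CrossedBiproduct.IsSetting.isBiproductBialgebra_iff ⟨hA, hB, hσε, hρ, hlact, hσ, hract, hψ⟩
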